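/- **Setting.** A stationary episodic MDP $\mathcal M$ has finite sets $\mathcal S,\mathcal A$ of states and actions, horizon $H$, initial law $p_0$, transition probabilities $p(x'|x,a)$, and rewards $R(x,a)\in[0,1]$ with mean $r(x,a)$. $V^\pi_h(x)$ is the expected reward of the policy $\pi=(\pi_h)$ from stage $h$ on when $x_h=x$ ($V^\pi_{H+1}=0$), $V^\pi_0=\sum_x p_0(x)V^\pi_1(x)$, $V^\star=\max_\pi V^\pi$, $Q^\star_h(x,a)=r(x,a)+\sum_{x'}p(x'|x,a)V^\star_{h+1}(x')$, $\mathrm{gap}_h(x,a)=V^\star_h(x)-Q^\star_h(x,a)$, and $\mathrm{gap}_{\min}$ is the smallest positive gap. A learner picks before each episode $k$ a policy $\pi_k$ from past information (possibly with private randomness) and observes one episode played with it; $\mathrm{Regret}_K=\sum_{k\le K}(V^\star_0-V^{\pi_k}_0)$. Let $n_k(x,a)$ be the number of visits of $(x,a)$ before episode $k$, and $\hat r_k(x,a)$, $\hat p_k(\cdot|x,a)$ the empirical mean reward and transition frequencies. If $n_k(x,a)=0$, then $\hat r_k(x,a)=0$ and $\hat p_k(\cdot|x,a)$ is any probability vector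 that vanishes where $p(\cdot|x,a)$ vanishes. **Instances.** Let $S\ge1$, $\epsilon\in(0,1/8)$, and let $\mathcal D$ be a symmetric law on $[-1,1]$ with variance at least $v>0$. Put $H=2$, $\mathcal A=\{-1,1\}$, $\mathcal S=\{-S,\dots,S\}$, $x_1=0$. From $0$, action $1$ leads to a uniform state in $\{1,\dots,S\}$ and action $-1$ to a uniform state in $\{-S,\dots,-1\}$; from $x\neq0$ (reached only at the last stage) transitions are arbitrary but do not depend on the action. Rewards are $0$ if $x=0$ or $a=-1$; for $1\le s\le S$, $R(s,1)\sim\frac12+\epsilon+\frac14\mathcal D$ and $R(-s,1)\sim\frac12+\frac14\mathcal D$. **Algorithms.** Fix constants $c_{\mathrm{bon}},\bar c_{\mathrm{bon}}>0$ and $\delta\in(0,1/8)$, and let $M=|\mathcal S||\mathcal A|H$. The algorithm computes from past information bonuses $b^{\mathrm{rw}}_k(x,a)$ and $b_{k,h}(x,a)$ and sets $\bar Q_{k,H}=\hat r_k+b^{\mathrm{rw}}_k$, $\bar V_{k,h}(x)=\max_a\bar Q_{k,h}(x,a)$, and for $h<H$ $$\bar Q_{k,h}(x,a)=\hat r_k(x,a)+b^{\mathrm{rw}}_k(x,a)+\sum_{x'}\hat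 p_k(x'|x,a)\bar V_{k,h+1}(x')+b_{k,h}(x,a);$$ it plays $\pi_{k,h}(x)\in\arg\max_a\bar Q_{k,h}(x,a)$, with any tie-breaking. With $n=1\vee n_k(x,a)$, almost surely for all $k,x,a$, $$b_{k,h}(x,a)\ge \frac{c_{\mathrm{bon}}}{n}\ (1\le h<H),\qquad c_{\mathrm{bon}}\sqrt{\frac{\mathrm{Var}[R(x,a)]\log(1/\delta)}{n}}\le b^{\mathrm{rw}}_k(x,a)\le\bar c_{\mathrm{bon}}\sqrt{\frac{\log(Mn/\delta)}{n}}.$$ Moreover it is $\delta$-correct, $\Pr[\forall x,a,k:\ b^{\mathrm{rw}}_k(x,a)+\hat r_k(x,a)\ge r(x,a)]\ge1-\delta$, and consistent: for every $\eta>0$ there is $k_0$ with $\Pr[\forall k\ge k_0:\ \bar V_{k,0}-V^\star_0\le\eta]\ge1-\delta$, where $\bar V_{k,0}=\sum_xp_0(x)\bar V_{k,1}(x)$. These properties are only required on the instance at hand. **Theorem.** There is a universal constant $C_0>0$, and for all $c_{\mathrm{bon}},\bar c_{\mathrm{bon}},v>0$ there are $c_1,c_2,c_3,C_1>0$ depending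 only on these three numbers, such that for all $\delta\in(0,1/8)$, $S\ge1$ and $\epsilon\in(0,1/8)$ with $\epsilon\le1/\lceil c_1S\log(S/\delta)\rceil$, every instance above with these parameters satisfies the following. 1. $|\mathcal S|=2S+1$, $|\mathcal A|=2$, $H=2$; $\mathrm{gap}_1(0,-1)=\mathrm{gap}_{\min}=\epsilon$; for $h\in\{1,2\}$, $\mathrm{gap}_h(x,1)=0$ for all $x$ and $\mathrm{gap}_h(x,-1)\ge\frac12$ for $x\ne0$; and every positive gap other than $\mathrm{gap}_1(0,-1)$ is at least $\frac12$. 2. $\displaystyle\sum_{h,x,a:\,\mathrm{gap}_h(x,a)>0}\frac1{\mathrm{gap}_h(x,a)}\le C_0\Big(S+\frac1{\epsilon}\Big)$. 3. $\displaystyle\sum_{h,x,a:\,\mathrm{gap}_h(x,a)>0}\frac1{\mathrm{gap}_h(x,a)}+\frac S{\epsilon}\le C_1\cdot\frac{c_2S}{\epsilon}\log\frac1\delta$. 4. For every algorithm as above run on the instance with confidence parameter $\delta$ there is $K_0$ such that for all $K\ge K_0$, $$\Pr\Big[\mathrm{Regret}_K\ge\frac{c_2S}{\mathrm{gap}_{\min}}\log\frac1\delta\Big]\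 \ge\ 1-c_2S\epsilon^{-2}\log(1/\delta)\,e^{-c_3S}-3\delta .$$ -/

import Mathlib

open MeasureTheory ProbabilityTheory
open scoped BigOperators

/-! ### Episodic Markov decision processes -/

/-- A stationary episodic MDP with finite state space `S`, finite action space `A`,
horizon `H`, initial distribution `p0`, transition probabilities `p x a x' = p(x' | x, a)`
and reward laws `R x a` supported in `[0, 1]`. -/
structure MDP (S A : Type) [Fintype S] where
  H : ℕ
  H_pos : 1 ≤ H
  p0 : S → ℝ
  p0_mem : p0 ∈ stdSimplex ℝ S
  p : S → A → S → ℝ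
  p_mem : ∀ x a, p x a ∈ stdSimplex ℝ S
  R : S → A → Measure ℝ
  R_prob : ∀ x a, IsProbabilityMeasure (R x a)
  R_supp : ∀ x a, R x a (Set.Icc 0 1)ᶜ = 0

namespace MDP

variable {S A : Type} [Fintype S]

/-- Expected reward `r(x, a)`. -/
noncomputable def r (M : MDP S A) (x : S) (a : A) : ℝ := ∫ y, y ∂(M.R x a)

/-- Variance of the reward `R(x, a)`. -/
noncomputable def rewardVar (M : MDP S A) (x : S) (a : A) : ℝ :=
  variance (fun y : ℝ => y) (M.R x a)

/-- Expected total reward of the policy `π` over the last `m` stages `H - m + 1, …, H`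
of the episode, when the first of these stages is started in the state `x`. -/
noncomputable def valueToGo (M : MDP S A) (π : ℕ → S → A) : ℕ → S → ℝ
  | 0 => fun _ => 0
  | m + 1 => fun x =>
      M.r x (π (M.H - m) x) + ∑ x', M.p x (π (M.H - m) x) x' * valueToGo M π m x'

/-- `V^π_h(x)`, for stages `1 ≤ h ≤ H + 1`, with `V^π_{H+1} = 0`. A policy `π` takes at stage
`h` in state `x` the action `π h x`; only `1 ≤ h ≤ H` matters. -/
noncomputable def value (M : MDP S A) (π : ℕ → S → A) (h : ℕ) (x : S) : ℝ :=
  M.valueToGo π (M.H + 1 - h) x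

/-- `V^π_0`, the expected total reward of `π` in an episode. -/
noncomputable def value0 (M : MDP S A) (π : ℕ → S → A) : ℝ :=
  ∑ x, M.p0 x * M.value π 1 x

/-- `V*_h(x)`. -/
noncomputable def optValue (M : MDP S A) (h : ℕ) (x : S) : ℝ :=
  ⨆ π : ℕ → S → A, M.value π h x

/-- `V*_0`. -/
noncomputable def optValue0 (M : MDP S A) : ℝ := ⨆ π : ℕ → S → A, M.value0 π

/-- `Q*_h(x, a)`. -/
noncomputable def optQ (M : MDP S A) (h : ℕ) (x : S) (a : A) : ℝ :=
  M.r x a + ∑ x', M.p x a x' * M.optValue (h + 1) x'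

/-- The suboptimality gap `gap_h(x, a) = V*_h(x) - Q*_h(x, a)`. -/
noncomputable def gap (M : MDP S A) (h : ℕ) (x : S) (a : A) : ℝ :=
  M.optValue h x - M.optQ h x a

/-- The set of positive gaps `gap_h(x, a)`, `h ∈ [H]`; `gap_min` is its least element. -/
def positiveGaps (M : MDP S A) : Set ℝ :=
  {g | ∃ h ∈ Finset.Icc 1 M.H, ∃ x a, M.gap h x a = g ∧ 0 < g}

open Classical in
/-- `∑ 1 / gap_h(x, a)` over all `h ∈ [H]`, `x`, `a` with `gap_h(x, a) > 0`. -/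
noncomputable def sumInvGaps [Fintype A] (M : MDP S A) : ℝ :=
  ∑ h ∈ Finset.Icc 1 M.H, ∑ x, ∑ a, if 0 < M.gap h x a then 1 / M.gap h x a else 0

end MDP

/-! ### Interaction of a learner with an MDP -/

/-- The random objects of an interaction. Episodes are numbered `k = 0, 1, 2, …` and stages
`h = 1, …, H`: `state k h` is `x_h` in episode `k` (for `1 ≤ h ≤ H + 1`), `reward k h` is the
reward received at stage `h`, and `policy k ω` is the policy `π_k` played in episode `k`. -/
structure Interaction (S A : Type) (Ω : Type*) where
  state : ℕ → ℕ → Ω → S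
  reward : ℕ → ℕ → Ω → ℝ
  policy : ℕ → Ω → ℕ → S → A

namespace Interaction

variable {S A : Type} {Ω : Type*}

/-- The action `a_h = π_{k,h}(x_h)` of episode `k`. -/
def action (τ : Interaction S A Ω) (k h : ℕ) (ω : Ω) : A :=
  τ.policy k ω h (τ.state k h ω)

open Classical in
/-- The pairs (episode, stage) before episode `k` at which `(x, a)` was visited. -/
noncomputable def visits (τ : Interaction S A Ω) (H k : ℕ) (x : S) (a : A) (ω : Ω) :
    Finset (ℕ × ℕ) :=
  (Finset.range k ×ˢ Finset.Icc 1 H).filter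
    (fun i => τ.state i.1 i.2 ω = x ∧ τ.action i.1 i.2 ω = a)

/-- `n_k(x, a)`, the number of visits of `(x, a)` before episode `k`. -/
noncomputable def count (τ : Interaction S A Ω) (H k : ℕ) (x : S) (a : A) (ω : Ω) : ℕ :=
  (τ.visits H k x a ω).card

open Classical in
/-- `n_k(x' | x, a)`, the number of those visits that were followed by the state `x'`. -/
noncomputable def countNext (τ : Interaction S A Ω) (H k : ℕ) (x : S) (a : A) (x' : S)
    (ω : Ω) : ℕ :=
  ((τ.visits H k x a ω).filter (fun i => τ.state i.1 (i.2 + 1) ω = x')).card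

/-- The empirical mean reward `r̂_k(x, a)` (equal to `0` before the first visit). -/
noncomputable def rhat (τ : Interaction S A Ω) (H k : ℕ) (x : S) (a : A) (ω : Ω) : ℝ :=
  (∑ i ∈ τ.visits H k x a ω, τ.reward i.1 i.2 ω) / (τ.count H k x a ω : ℝ)

/-- The regret of the first `K` episodes, `∑_k (V*_0 - V^{π_k}_0)`. -/
noncomputable def regret [Fintype S] (τ : Interaction S A Ω) (M : MDP S A) (K : ℕ) (ω : Ω) : ℝ :=
  ∑ k ∈ Finset.range K, (M.optValue0 - M.value0 (τ.policy k ω))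

end Interaction

/-- `τ` is an interaction with the MDP `M` under the probability measure `P`. Here `G k 0` is the
information available when episode `k` starts (it may contain private randomness of the learner),
and `G k h` the information available in episode `k` when `x_h` has been observed. The policy
`π_k` is chosen from `G k 0`; given `G k 0` the initial state is drawn from `p0`; given `G k h`
the reward and the next state are drawn independently from `R(x_h, a_h)` and `p(x_h, a_h)`. -/
structure IsInteraction {S A : Type} [Fintype S] {Ω : Type*} [mΩ : MeasurableSpace Ω]
    (M : MDP S A) (P : Measure Ω) (G : ℕ → ℕ → MeasurableSpace Ω)
    (τ : Interaction S A Ω) : Prop where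
  G_le : ∀ k h, G k h ≤ mΩ
  G_stage : ∀ k h, h ≤ M.H → G k h ≤ G k (h + 1)
  G_episode : ∀ k, G k (M.H + 1) ≤ G (k + 1) 0
  policy_meas : ∀ k h x a, MeasurableSet[G k 0] {ω | τ.policy k ω h x = a}
  state_meas : ∀ k, ∀ h ∈ Finset.Icc 1 (M.H + 1), ∀ x,
    MeasurableSet[G k h] {ω | τ.state k h ω = x}
  reward_meas : ∀ k, ∀ h ∈ Finset.Icc 1 M.H, Measurable[G k (h + 1)] (τ.reward k h)
  init_law : ∀ k x, P⟦{ω | τ.state k 1 ω = x} | G k 0⟧ =ᵐ[P] fun _ => M.p0 x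
  step_law : ∀ k, ∀ h ∈ Finset.Icc 1 M.H, ∀ B : Set ℝ, MeasurableSet B → ∀ x',
    P⟦{ω | τ.reward k h ω ∈ B ∧ τ.state k (h + 1) ω = x'} | G k h⟧ =ᵐ[P]
      fun ω => (M.R (τ.state k h ω) (τ.action k h ω)).real B *
        M.p (τ.state k h ω) (τ.action k h ω) x'

/-! ### Model-based optimistic algorithms -/

/-- The quantities from which the optimistic Q-functions are computed, in addition to the
empirical estimates: the reward bonus `b^rw_k(x, a)`, the bonus `b_{k,h}(x, a)`, and the estimate
`phatInit k x a x'` of `p(x' | x, a)` in use as long as `(x, a)` was not visited. -/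
structure Bonuses (S A : Type) (Ω : Type*) where
  rew : ℕ → S → A → Ω → ℝ
  stage : ℕ → ℕ → S → A → Ω → ℝ
  phatInit : ℕ → S → A → S → Ω → ℝ

namespace Bonuses

variable {S A : Type} [Fintype S] {Ω : Type*}

/-- `p̂_k(x' | x, a)`. -/
noncomputable def phat (b : Bonuses S A Ω) (τ : Interaction S A Ω) (H k : ℕ) (x : S) (a : A)
    (x' : S) (ω : Ω) : ℝ :=
  if τ.count H k x a ω = 0 then b.phatInit k x a x' ω
  else (τ.countNext H k x a x' ω : ℝ) / (τ.count H k x a ω : ℝ)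

/-- The optimistic Q-function of episode `k` at stage `H - m`. -/
noncomputable def optQAux (b : Bonuses S A Ω) (τ : Interaction S A Ω) (H k : ℕ) (ω : Ω) :
    ℕ → S → A → ℝ
  | 0 => fun x a => τ.rhat H k x a ω + b.rew k x a ω
  | m + 1 => fun x a =>
      τ.rhat H k x a ω + b.rew k x a ω
        + ∑ x', b.phat τ H k x a x' ω * (⨆ a', optQAux b τ H k ω m x' a')
        + b.stage k (H - (m + 1)) x a ω

/-- The optimistic Q-function `Q̄_{k,h}(x, a)`, `1 ≤ h ≤ H`. -/
noncomputable def optQ (b : Bonuses S A Ω) (τ : Interaction S A Ω) (H k h : ℕ) (x : S) (a : A)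
    (ω : Ω) : ℝ :=
  b.optQAux τ H k ω (H - h) x a

/-- `V̄_{k,h}(x) = max_a Q̄_{k,h}(x, a)`. -/
noncomputable def optV (b : Bonuses S A Ω) (τ : Interaction S A Ω) (H k h : ℕ) (x : S)
    (ω : Ω) : ℝ :=
  ⨆ a, b.optQ τ H k h x a ω

/-- `V̄_{k,0}`, the average of `V̄_{k,1}` over the initial distribution. -/
noncomputable def optV0 (b : Bonuses S A Ω) (τ : Interaction S A Ω) (M : MDP S A) (k : ℕ)
    (ω : Ω) : ℝ :=
  ∑ x, M.p0 x * b.optV τ M.H k 1 x ω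

end Bonuses

/-- The interaction `τ` with `M` is a run, with confidence parameter `δ`, of a model-based
optimistic algorithm with the bonuses `b` and with the constants `cbon`, `cbar`. -/
structure IsOptimisticRun {S A : Type} [Fintype S] [Fintype A] {Ω : Type*} [MeasurableSpace Ω]
    (M : MDP S A) (P : Measure Ω) (G : ℕ → ℕ → MeasurableSpace Ω) (τ : Interaction S A Ω)
    (b : Bonuses S A Ω) (cbon cbar δ : ℝ) : Prop where
  interaction : IsInteraction M P G τ
  rew_meas : ∀ k x a, Measurable[G k 0] (b.rew k x a)
  stage_meas : ∀ k h x a, Measurable[G k 0] (b.stage k h x a)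
  phatInit_meas : ∀ k x a x', Measurable[G k 0] (b.phatInit k x a x')
  /-- The transition estimates are probability vectors that charge no impossible transition
  (for visited pairs this holds automatically). -/
  phatInit_prob : ∀ᵐ ω ∂P, ∀ k x a, (fun x' => b.phatInit k x a x' ω) ∈ stdSimplex ℝ S ∧
    ∀ x', M.p x a x' = 0 → b.phatInit k x a x' ω = 0
  /-- `π_{k,h}(x)` maximizes `Q̄_{k,h}(x, ·)`, ties being broken in any way. -/
  greedy : ∀ᵐ ω ∂P, ∀ k, ∀ h ∈ Finset.Icc 1 M.H, ∀ x a,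
    b.optQ τ M.H k h x a ω ≤ b.optQ τ M.H k h x (τ.policy k ω h x) ω
  stage_lower : ∀ᵐ ω ∂P, ∀ k x a, ∀ h ∈ Finset.Ico 1 M.H,
    cbon / max 1 (τ.count M.H k x a ω : ℝ) ≤ b.stage k h x a ω
  rew_lower : ∀ᵐ ω ∂P, ∀ k x a,
    cbon * Real.sqrt (M.rewardVar x a * Real.log (1 / δ) / max 1 (τ.count M.H k x a ω : ℝ))
      ≤ b.rew k x a ω
  rew_upper : ∀ᵐ ω ∂P, ∀ k x a,
    b.rew k x a ω ≤ cbar * Real.sqrt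
      (Real.log (((Fintype.card S * Fintype.card A * M.H : ℕ) : ℝ)
          * max 1 (τ.count M.H k x a ω : ℝ) / δ)
        / max 1 (τ.count M.H k x a ω : ℝ))
  /-- The reward bonuses are `δ`-correct. -/
  correct : 1 - δ ≤ P.real {ω | ∀ k x a, M.r x a ≤ b.rew k x a ω + τ.rhat M.H k x a ω}
  /-- The optimistic value is consistent. -/
  consistent : ∀ η : ℝ, 0 < η → ∃ k₀ : ℕ,
    1 - δ ≤ P.real {ω | ∀ k, k₀ ≤ k → b.optV0 τ M k ω - M.optValue0 ≤ η}

/-! ### The hard instance -/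

/-- The state space `{-S, …, -1, 0, 1, …, S}`. The action space `{-1, 1}` is `ℤˣ`. -/
abbrev HardState (S : ℕ) : Type := ↥(Finset.Icc (-(S : ℤ)) (S : ℤ))

/-- The state `0`. -/
def hardOrigin (S : ℕ) : HardState S := ⟨0, by simp⟩

/-- `D` is a symmetric probability law on `[-1, 1]` with variance at least `v`. -/
structure IsSymmetricNoise (v : ℝ) (D : Measure ℝ) : Prop where
  prob : IsProbabilityMeasure D
  supp : D (Set.Icc (-1) 1)ᶜ = 0
  symm : D.map (fun y => -y) = D
  var : v ≤ variance (fun y : ℝ => y) D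

/-- Reward laws: `0` if `x = 0` or `a = -1`; `1/2 + ε + D/4` at `(s, 1)` and `1/2 + D/4` at
`(-s, 1)`, for `s ∈ [S]`. -/
noncomputable def hardReward (S : ℕ) (ε : ℝ) (D : Measure ℝ) (x : HardState S) (a : ℤˣ) :
    Measure ℝ :=
  if (x : ℤ) = 0 ∨ a = -1 then Measure.dirac 0
  else if 0 < (x : ℤ) then D.map (fun y => 1 / 2 + ε + 1 / 4 * y)
  else D.map (fun y => 1 / 2 + 1 / 4 * y)

/-- Transitions: from `0`, action `1` leads to a uniform element of `{1, …, S}` and action `-1`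
to a uniform element of `{-S, …, -1}`. From `x ≠ 0`, which is only reached at the last stage, the
law `q x` is arbitrary, but the same for both actions. -/
noncomputable def hardTransition (S : ℕ) (q : HardState S → HardState S → ℝ) (x : HardState S)
    (a : ℤˣ) (x' : HardState S) : ℝ :=
  if (x : ℤ) = 0 then (if 0 < (a : ℤ) * (x' : ℤ) then 1 / (S : ℝ) else 0) else q x x'

theorem card_hard_side (S : ℕ) (a : ℤˣ) :
    (Finset.univ.filter (fun x : HardState S => 0 < (a : ℤ) * (x : ℤ))).card = S := by
  have key : ((Finset.Icc (-(S : ℤ)) (S : ℤ)).filter (fun z => 0 < (a : ℤ) * z)).card = S := by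
    rcases Int.units_eq_one_or a with rfl | rfl
    · have : (Finset.Icc (-(S : ℤ)) (S : ℤ)).filter (fun z => 0 < ((1 : ℤˣ) : ℤ) * z)
          = Finset.Icc 1 (S : ℤ) := by
        ext z; simp only [Finset.mem_filter, Finset.mem_Icc, Units.val_one]; omega
      rw [this]; simp
    · have : (Finset.Icc (-(S : ℤ)) (S : ℤ)).filter (fun z => 0 < ((-1 : ℤˣ) : ℤ) * z)
          = Finset.Icc (-(S : ℤ)) (-1) := by
        ext z; simp only [Finset.mem_filter, Finset.mem_Icc, Units.val_neg, Units.val_one]; omega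
      rw [this]; simp
  rw [← Finset.card_map (Function.Embedding.subtype _)]
  conv_rhs => rw [← key]
  congr 1
  ext z
  simp only [Finset.mem_map, Finset.mem_filter, Finset.mem_univ, true_and,
    Function.Embedding.subtype_apply]
  constructor
  · rintro ⟨x, hx, rfl⟩; exact ⟨x.2, hx⟩
  · rintro ⟨hz, h⟩; exact ⟨⟨z, hz⟩, h, rfl⟩

theorem hardTransition_mem (S : ℕ) (hS : 1 ≤ S) (q : HardState S → HardState S → ℝ)
    (hq : ∀ x, q x ∈ stdSimplex ℝ (HardState S)) (x : HardState S) (a : ℤˣ) :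
    hardTransition S q x a ∈ stdSimplex ℝ (HardState S) := by
  by_cases hx : (x : ℤ) = 0
  · refine ⟨fun x' => ?_, ?_⟩
    · simp only [hardTransition, hx, if_true]; split_ifs <;> positivity
    · simp only [hardTransition, hx, if_true]
      rw [← Finset.sum_filter, Finset.sum_const, card_hard_side, nsmul_eq_mul]
      have : (S : ℝ) ≠ 0 := by positivity
      field_simp
  · have : hardTransition S q x a = q x := by funext x'; simp [hardTransition, hx]
    rw [this]; exact hq x

theorem hardReward_prob (S : ℕ) (ε : ℝ) {v : ℝ} {D : Measure ℝ} (hD : IsSymmetricNoise v D)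
    (x : HardState S) (a : ℤˣ) : IsProbabilityMeasure (hardReward S ε D x a) := by
  have := hD.prob
  unfold hardReward
  split_ifs
  · infer_instance
  · exact Measure.isProbabilityMeasure_map (by fun_prop)
  · exact Measure.isProbabilityMeasure_map (by fun_prop)

theorem hardReward_supp (S : ℕ) {ε : ℝ} (h0 : 0 < ε) (h1 : ε < 1 / 8) {v : ℝ} {D : Measure ℝ}
    (hD : IsSymmetricNoise v D) (x : HardState S) (a : ℤˣ) :
    hardReward S ε D x a (Set.Icc 0 1)ᶜ = 0 := by
  unfold hardReward
  split_ifs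
  · rw [Measure.dirac_apply' _ measurableSet_Icc.compl]; simp
  all_goals
    rw [Measure.map_apply (by fun_prop) measurableSet_Icc.compl]
    refine measure_mono_null ?_ hD.supp
    intro y hy hy'
    apply hy
    simp only [Set.mem_Icc] at hy' ⊢
    constructor <;> linarith [hy'.1, hy'.2]

/-- The hard instance with `H = 2`, started in the state `0`. -/
noncomputable def hardMDP (S : ℕ) (hS : 1 ≤ S) (ε : ℝ) (h0 : 0 < ε) (h1 : ε < 1 / 8) {v : ℝ}
    (D : Measure ℝ) (hD : IsSymmetricNoise v D) (q : HardState S → HardState S → ℝ)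
    (hq : ∀ x, q x ∈ stdSimplex ℝ (HardState S)) : MDP (HardState S) ℤˣ where
  H := 2
  H_pos := by norm_num
  p0 := Pi.single (hardOrigin S) 1
  p0_mem := single_mem_stdSimplex ℝ _
  p := hardTransition S q
  p_mem := hardTransition_mem S hS q hq
  R := hardReward S ε D
  R_prob := hardReward_prob S ε hD
  R_supp := hardReward_supp S h0 h1 hD

/-! ### Integrals against a conditionally independent variable -/

section CondIndep

open scoped ENNReal

variable {Ω : Type*} {m mΩ : MeasurableSpace Ω}

/-! Let N be the number of episodes before a late episode K that began with the wrong action `-1`,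
and Λ = log(1/δ). Each of them costs regret at least ε, so it suffices to show that N is at least a
constant times SΛ/ε². Consistency with tolerance ε forces the optimistic value of `-1` at the origin
down to 1/2 + 2ε, while its true value is 1/2.

The reward bonuses protect every negative state separately: a state with m visits of action `1` has
a bonus of order √(Λ/m). When the N visits are spread over S states, the bonuses averaged with the
empirical transition frequencies are of order √(SΛ/N). The reward noise, however, enters this
average pooled over all negative states, as one martingale divided by N. For a small constant c it
is at least -2√(cSΛ/N), except with probability exp(-cSΛ) for each value of N. It cannot offset the
bonuses, so √(SΛ/N) is at most of order ε (`count_lower_bound`).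

The spreading needs N to be large compared with S log(S/δ). This comes from the transition bonus:
`cbon / N` is at most 2ε, and ε is small by assumption (`optQ_one_neg_one_ge`). Then no negative
state receives more than 4N/S visits (`measureReal_visits_le`). Visits of `(x, -1)` waste at most
half of N, since each state admits only O(log(S/δ)) of them (`count_neg_one_le`).

`wrongCount_lower_bound` assembles this on a fixed trajectory, and `hardMDP_regret_lower_bound` adds
up the failure probabilities: δ each for consistency, correctness and the visit counts, and an
exponentially small term in S for the noise. -/

theorem setLIntegral_of_measure_inter {μ : Measure Ω} [IsFiniteMeasure μ] (hm : m ≤ mΩ)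
    {T : Set Ω} {c : ℝ≥0∞} (h : ∀ E, MeasurableSet[m] E → μ (E ∩ T) = c * μ E)
    {Z : Ω → ℝ≥0∞} (hZ : Measurable[m] Z) :
    ∫⁻ ω in T, Z ω ∂μ = c * ∫⁻ ω, Z ω ∂μ := by
  -- On the smaller σ-algebra, restricting to T is the same as scaling by c, so integrals of
  -- functions measurable for it agree too.
  have key : (μ.restrict T).trim hm = (c • μ).trim hm := by
    refine @Measure.ext _ m _ _ fun E hE => ?_
    rw [trim_measurableSet_eq hm hE, trim_measurableSet_eq hm hE,
      Measure.restrict_apply (hm E hE), h E hE]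
    rfl
  rw [← lintegral_trim hm hZ, key, lintegral_trim hm hZ, lintegral_smul_measure, smul_eq_mul]

theorem lintegral_mul_comp_of_measure_inter {μ : Measure Ω} [IsFiniteMeasure μ] (hm : m ≤ mΩ)
    {ν : Measure ℝ} {Y : Ω → ℝ} (hY : Measurable Y)
    (h : ∀ E, MeasurableSet[m] E → ∀ B, MeasurableSet B → μ (E ∩ Y ⁻¹' B) = ν B * μ E)
    {Z : Ω → ℝ≥0∞} (hZ : Measurable[m] Z) {g : ℝ → ℝ≥0∞} (hg : Measurable g) :
    ∫⁻ ω, Z ω * g (Y ω) ∂μ = (∫⁻ y, g y ∂ν) * ∫⁻ ω, Z ω ∂μ := by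
  have hZ' : Measurable Z := hZ.mono hm le_rfl
  -- Independence of Y from `m` survives the change of measure with the `m`-measurable density Z:
  -- only the total mass changes.
  have key : (μ.withDensity Z).map Y = (∫⁻ ω, Z ω ∂μ) • ν := by
    ext B hB
    rw [Measure.map_apply hY hB, withDensity_apply _ (hY hB),
      setLIntegral_of_measure_inter hm (fun E hE => h E hE B hB) hZ]
    simp [mul_comm]
  have h1 := lintegral_withDensity_eq_lintegral_mul μ hZ' (hg.comp hY)
  simp only [Pi.mul_apply, Function.comp_apply] at h1
  rw [← h1, ← lintegral_map hg hY, key, lintegral_smul_measure, smul_eq_mul, mul_comm]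

end CondIndep

/-! ### Consequences of the conditional laws of an interaction -/

namespace IsInteraction

open scoped ENNReal

variable {S A : Type} [Fintype S] {Ω : Type*} [mΩ : MeasurableSpace Ω]
  {M : MDP S A} {P : Measure Ω} {G : ℕ → ℕ → MeasurableSpace Ω} {τ : Interaction S A Ω}

theorem G_zero_le (hτ : IsInteraction M P G τ) (k : ℕ) {h : ℕ} (hh : h ≤ M.H + 1) :
    G k 0 ≤ G k h := by
  induction h with
  | zero => exact le_rfl
  | succ h ih => exact (ih (by omega)).trans (hτ.G_stage k h (by omega))

theorem G_le_next (hτ : IsInteraction M P G τ) (k : ℕ) {h : ℕ} (hh : h ≤ M.H + 1) :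
    G k h ≤ G (k + 1) 0 := by
  induction hh using Nat.decreasingInduction with
  | self => exact hτ.G_episode k
  | of_succ n hn ih => exact (hτ.G_stage k n (by omega)).trans ih

/-- The event that the pair `(x, a)` is visited at stage `h` of episode `k`. -/
theorem measurableSet_visit (hτ : IsInteraction M P G τ) (k : ℕ) {h : ℕ}
    (hh : h ∈ Finset.Icc 1 M.H) (x : S) (a : A) :
    MeasurableSet[G k h] {ω | τ.state k h ω = x ∧ τ.action k h ω = a} := by
  have hh' := Finset.mem_Icc.1 hh
  have : {ω | τ.state k h ω = x ∧ τ.action k h ω = a}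
      = {ω | τ.state k h ω = x} ∩ {ω | τ.policy k ω h x = a} := by
    ext ω
    simp only [Set.mem_ofPred_eq, Set.mem_inter_iff, Interaction.action]
    constructor
    · rintro ⟨rfl, h2⟩; exact ⟨rfl, h2⟩
    · rintro ⟨rfl, h2⟩; exact ⟨rfl, h2⟩
  rw [this]
  exact (hτ.state_meas k h (Finset.mem_Icc.2 ⟨hh'.1, by omega⟩) x).inter
    (hτ.G_zero_le k (by omega) _ (hτ.policy_meas k h x a))

theorem measurableSet_next (hτ : IsInteraction M P G τ) (k : ℕ) {h : ℕ}
    (hh : h ∈ Finset.Icc 1 M.H) (x : S) :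
    MeasurableSet {ω | τ.state k (h + 1) ω = x} := by
  have hh' := Finset.mem_Icc.1 hh
  exact hτ.G_le k (h + 1) _
    (hτ.state_meas k (h + 1) (Finset.mem_Icc.2 ⟨by omega, by omega⟩) x)

theorem measurable_reward (hτ : IsInteraction M P G τ) (k : ℕ) {h : ℕ}
    (hh : h ∈ Finset.Icc 1 M.H) : Measurable (τ.reward k h) :=
  (hτ.reward_meas k h hh).mono (hτ.G_le k (h + 1)) le_rfl

/-- A conditional inequality may be checked on each visited pair separately. -/
theorem lintegral_le_of_visit [Finite A] (hτ : IsInteraction M P G τ) (k : ℕ) {h : ℕ}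
    (hh : h ∈ Finset.Icc 1 M.H) {F Z : Ω → ℝ≥0∞}
    (hle : ∀ x a, ∫⁻ ω in {ω | τ.state k h ω = x ∧ τ.action k h ω = a}, F ω ∂P
      ≤ ∫⁻ ω in {ω | τ.state k h ω = x ∧ τ.action k h ω = a}, Z ω ∂P) :
    ∫⁻ ω, F ω ∂P ≤ ∫⁻ ω, Z ω ∂P := by
  have hU : (⋃ i : S × A, {ω | τ.state k h ω = i.1 ∧ τ.action k h ω = i.2}) = Set.univ := by
    ext ω
    simp only [Set.mem_iUnion, Set.mem_univ, iff_true]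
    exact ⟨(_, _), rfl, rfl⟩
  have hm : ∀ i : S × A, MeasurableSet {ω | τ.state k h ω = i.1 ∧ τ.action k h ω = i.2} :=
    fun i => hτ.G_le k h _ (hτ.measurableSet_visit k hh i.1 i.2)
  have hd : Pairwise (Function.onFun Disjoint
      fun i : S × A => {ω | τ.state k h ω = i.1 ∧ τ.action k h ω = i.2}) := by
    intro i j hij
    refine Set.disjoint_left.2 fun ω h1 h2 => hij ?_
    exact Prod.ext (h1.1.symm.trans h2.1) (h1.2.symm.trans h2.2)
  rw [← setLIntegral_univ F, ← setLIntegral_univ Z, ← hU, lintegral_iUnion hm hd,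
    lintegral_iUnion hm hd]
  exact ENNReal.tsum_le_tsum fun i => hle i.1 i.2

variable [IsProbabilityMeasure P]

theorem measure_init (hτ : IsInteraction M P G τ) (k : ℕ) (x : S) :
    P {ω | τ.state k 1 ω = x} = ENNReal.ofReal (M.p0 x) := by
  have hms : MeasurableSet {ω | τ.state k 1 ω = x} := hτ.G_le k 1 _
    (hτ.state_meas k 1 (Finset.mem_Icc.2 ⟨le_rfl, by omega⟩) x)
  have h1 := integral_condExp (μ := P) (hτ.G_le k 0)
    (f := {ω | τ.state k 1 ω = x}.indicator fun _ => (1 : ℝ))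
  rw [integral_congr_ae (hτ.init_law k x), integral_indicator hms] at h1
  simp only [integral_const, smul_eq_mul, mul_one, probReal_univ, one_mul,
    measureReal_restrict_apply_univ] at h1
  rw [h1, ofReal_measureReal]

/-- On the event that a fixed pair is visited, the random kernel of `step_law` is constant. The
conditional law thus becomes a product formula for measures of events, which is all that the later
integrals need. -/
theorem measure_step (hτ : IsInteraction M P G τ) (k : ℕ) {h : ℕ}
    (hh : h ∈ Finset.Icc 1 M.H) (x : S) (a : A) {E : Set Ω} (hE : MeasurableSet[G k h] E)
    {B : Set ℝ} (hB : MeasurableSet B) (x' : S) :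
    P (E ∩ {ω | τ.state k h ω = x ∧ τ.action k h ω = a}
        ∩ {ω | τ.reward k h ω ∈ B ∧ τ.state k (h + 1) ω = x'})
      = M.R x a B * ENNReal.ofReal (M.p x a x')
        * P (E ∩ {ω | τ.state k h ω = x ∧ τ.action k h ω = a}) := by
  have := M.R_prob x a
  set V := {ω | τ.state k h ω = x ∧ τ.action k h ω = a} with hV
  set T := {ω | τ.reward k h ω ∈ B ∧ τ.state k (h + 1) ω = x'} with hTdef
  have hVm := hτ.measurableSet_visit k hh x a
  have hEV : MeasurableSet[G k h] (E ∩ V) := hE.inter hVm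
  have hT : MeasurableSet T := (hτ.measurable_reward k hh hB).inter (hτ.measurableSet_next k hh x')
  have h1 := setIntegral_condExp (μ := P) (hτ.G_le k h)
    (f := T.indicator fun _ => (1 : ℝ)) ((integrable_const 1).indicator hT) hEV
  rw [setIntegral_congr_ae (g := fun _ => (M.R x a).real B * M.p x a x')
    (hτ.G_le k h _ hEV) ((hτ.step_law k h hh B hB x').mono ?_)] at h1
  · rw [setIntegral_const, integral_indicator hT, Measure.restrict_restrict hT, setIntegral_const,
      smul_eq_mul, smul_eq_mul, mul_one, Set.inter_comm T] at h1
    have hp := (M.p_mem x a).1 x'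
    rw [← ofReal_measureReal (μ := P), ← ofReal_measureReal (μ := P),
      ← ofReal_measureReal (μ := M.R x a), ← ENNReal.ofReal_mul (by positivity),
      ← ENNReal.ofReal_mul (by positivity), ← h1, mul_comm]
  · intro ω hω hmem
    have h2 : τ.state k h ω = x := hmem.2.1
    have h3 : τ.action k h ω = a := hmem.2.2
    rw [hω]
    simp only [h2, h3]

theorem measure_next (hτ : IsInteraction M P G τ) (k : ℕ) {h : ℕ}
    (hh : h ∈ Finset.Icc 1 M.H) (x : S) (a : A) {E : Set Ω} (hE : MeasurableSet[G k h] E)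
    (x' : S) :
    P (E ∩ {ω | τ.state k h ω = x ∧ τ.action k h ω = a} ∩ {ω | τ.state k (h + 1) ω = x'})
      = ENNReal.ofReal (M.p x a x')
        * P (E ∩ {ω | τ.state k h ω = x ∧ τ.action k h ω = a}) := by
  have := M.R_prob x a
  simpa using hτ.measure_step k hh x a hE MeasurableSet.univ x'

theorem measure_reward (hτ : IsInteraction M P G τ) (k : ℕ) {h : ℕ}
    (hh : h ∈ Finset.Icc 1 M.H) (x : S) (a : A) {E : Set Ω} (hE : MeasurableSet[G k h] E)
    {B : Set ℝ} (hB : MeasurableSet B) :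
    P (E ∩ {ω | τ.state k h ω = x ∧ τ.action k h ω = a} ∩ τ.reward k h ⁻¹' B)
      = M.R x a B * P (E ∩ {ω | τ.state k h ω = x ∧ τ.action k h ω = a}) := by
  set V := {ω | τ.state k h ω = x ∧ τ.action k h ω = a} with hV
  have hVm := hτ.measurableSet_visit k hh x a
  have hEV : MeasurableSet (E ∩ V) := hτ.G_le k h _ (hE.inter hVm)
  have hU : E ∩ V ∩ τ.reward k h ⁻¹' B
      = ⋃ x', E ∩ V ∩ {ω | τ.reward k h ω ∈ B ∧ τ.state k (h + 1) ω = x'} := by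
    ext ω
    simp only [Set.mem_inter_iff, Set.mem_preimage, Set.mem_iUnion, Set.mem_ofPred_eq]
    constructor
    · rintro ⟨h1, h2⟩; exact ⟨_, h1, h2, rfl⟩
    · rintro ⟨_, h1, h2, _⟩; exact ⟨h1, h2⟩
  rw [hU, measure_iUnion]
  · simp_rw [hV, hτ.measure_step k hh x a hE hB]
    rw [tsum_fintype, ← Finset.sum_mul, ← Finset.mul_sum,
      ← ENNReal.ofReal_sum_of_nonneg (fun i _ => (M.p_mem x a).1 i), (M.p_mem x a).2]
    simp
  · intro i j hij
    refine Set.disjoint_left.2 fun ω h1 h2 => hij ?_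
    exact h1.2.2.symm.trans h2.2.2
  · intro i
    exact hEV.inter ((hτ.measurable_reward k hh hB).inter (hτ.measurableSet_next k hh i))

theorem setLIntegral_next (hτ : IsInteraction M P G τ) (k : ℕ) {h : ℕ}
    (hh : h ∈ Finset.Icc 1 M.H) (x : S) (a : A) {Z : Ω → ℝ≥0∞} (hZ : Measurable[G k h] Z)
    (x' : S) :
    ∫⁻ ω in {ω | τ.state k h ω = x ∧ τ.action k h ω = a} ∩ {ω | τ.state k (h + 1) ω = x'}, Z ω ∂P
      = ENNReal.ofReal (M.p x a x')
        * ∫⁻ ω in {ω | τ.state k h ω = x ∧ τ.action k h ω = a}, Z ω ∂P := by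
  have hVm := hτ.G_le k h _ (hτ.measurableSet_visit k hh x a)
  have hTm := hτ.measurableSet_next k hh x'
  rw [Set.inter_comm, ← Measure.restrict_restrict hTm]
  refine setLIntegral_of_measure_inter (hτ.G_le k h) (fun E hE => ?_) hZ
  have hE' := hτ.G_le k h _ hE
  rw [Measure.restrict_apply (hE'.inter hTm), Measure.restrict_apply hE',
    ← hτ.measure_next k hh x a hE, Set.inter_right_comm]

theorem setLIntegral_reward (hτ : IsInteraction M P G τ) (k : ℕ) {h : ℕ}
    (hh : h ∈ Finset.Icc 1 M.H) (x : S) (a : A) {Z : Ω → ℝ≥0∞} (hZ : Measurable[G k h] Z)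
    {g : ℝ → ℝ≥0∞} (hg : Measurable g) :
    ∫⁻ ω in {ω | τ.state k h ω = x ∧ τ.action k h ω = a}, Z ω * g (τ.reward k h ω) ∂P
      = (∫⁻ y, g y ∂(M.R x a))
        * ∫⁻ ω in {ω | τ.state k h ω = x ∧ τ.action k h ω = a}, Z ω ∂P := by
  have hrm := hτ.measurable_reward k hh
  refine lintegral_mul_comp_of_measure_inter (hτ.G_le k h) hrm (fun E hE B hB => ?_) hZ hg
  have hE' := hτ.G_le k h _ hE
  rw [Measure.restrict_apply (hE'.inter (hrm hB)), Measure.restrict_apply hE',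
    ← hτ.measure_reward k hh x a hE hB, Set.inter_right_comm]

/-! ### Almost sure properties of the trajectory -/

theorem ae_state_init (hτ : IsInteraction M P G τ) (k : ℕ) :
    ∀ᵐ ω ∂P, M.p0 (τ.state k 1 ω) ≠ 0 := by
  rw [ae_iff]
  refine measure_mono_null (t := ⋃ x ∈ {x | M.p0 x = 0}, {ω | τ.state k 1 ω = x}) ?_ ?_
  · intro ω hω
    simp only [Set.mem_ofPred_eq, not_not] at hω
    simp [hω]
  · refine (measure_biUnion_null_iff (Set.to_countable _)).2 fun x hx => ?_
    have hx' : M.p0 x = 0 := hx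
    rw [hτ.measure_init, hx', ENNReal.ofReal_zero]

theorem ae_state_next [Finite A] (hτ : IsInteraction M P G τ) (k : ℕ) {h : ℕ}
    (hh : h ∈ Finset.Icc 1 M.H) :
    ∀ᵐ ω ∂P, M.p (τ.state k h ω) (τ.action k h ω) (τ.state k (h + 1) ω) ≠ 0 := by
  rw [ae_iff]
  refine measure_mono_null (t := ⋃ i ∈ {i : S × A × S | M.p i.1 i.2.1 i.2.2 = 0},
    {ω | τ.state k h ω = i.1 ∧ τ.action k h ω = i.2.1} ∩ {ω | τ.state k (h + 1) ω = i.2.2}) ?_ ?_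
  · intro ω hω
    simp only [Set.mem_ofPred_eq, not_not] at hω
    simp only [Set.mem_iUnion]
    exact ⟨(_, _, _), hω, ⟨rfl, rfl⟩, rfl⟩
  · refine (measure_biUnion_null_iff (Set.to_countable _)).2 fun i hi => ?_
    have := hτ.measure_next k hh i.1 i.2.1 MeasurableSet.univ i.2.2
    have hi' : M.p i.1 i.2.1 i.2.2 = 0 := hi
    rw [Set.univ_inter, hi'] at this
    simpa using this

theorem ae_reward_eq_zero (hτ : IsInteraction M P G τ) (k : ℕ) {h : ℕ}
    (hh : h ∈ Finset.Icc 1 M.H) {x : S} {a : A} (hR : M.R x a = Measure.dirac 0) :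
    ∀ᵐ ω ∂P, τ.state k h ω = x → τ.action k h ω = a → τ.reward k h ω = 0 := by
  rw [ae_iff]
  have := hτ.measure_reward k hh x a MeasurableSet.univ (B := {0}ᶜ)
    (measurableSet_singleton _).compl
  rw [hR, Set.univ_inter, Measure.dirac_apply' _ (measurableSet_singleton _).compl] at this
  simp only [Set.mem_compl_iff, Set.mem_singleton_iff, not_true_eq_false, not_false_eq_true,
    Set.indicator_of_notMem, zero_mul] at this
  refine measure_mono_null ?_ this
  intro ω hω
  simp only [Set.mem_ofPred_eq, Classical.not_imp] at hω
  exact ⟨⟨hω.1, hω.2.1⟩, hω.2.2⟩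

end IsInteraction

/-! ### Moments of the noise -/

namespace IsSymmetricNoise

variable {v : ℝ} {D : Measure ℝ}

theorem ae_mem (hD : IsSymmetricNoise v D) : ∀ᵐ y ∂D, y ∈ Set.Icc (-1 : ℝ) 1 := by
  rw [ae_iff]; exact hD.supp

theorem integrable (hD : IsSymmetricNoise v D) : Integrable (fun y : ℝ => y) D := by
  have := hD.prob
  exact Integrable.of_mem_Icc (-1) 1 aemeasurable_id hD.ae_mem

theorem integral_eq_zero (hD : IsSymmetricNoise v D) : ∫ y, y ∂D = 0 := by
  have h1 : ∫ y, y ∂(D.map fun y => -y) = ∫ y, -y ∂D :=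
    integral_map (φ := fun y : ℝ => -y) (f := fun y : ℝ => y) (by fun_prop) (by fun_prop)
  rw [hD.symm, integral_neg] at h1
  linarith

theorem integral_affine (hD : IsSymmetricNoise v D) (c d : ℝ) :
    ∫ y, y ∂(D.map fun y => c + d * y) = c := by
  have := hD.prob
  rw [integral_map (φ := fun y : ℝ => c + d * y) (f := fun y : ℝ => y) (by fun_prop)
    (by fun_prop), integral_add (integrable_const _) (hD.integrable.const_mul _),
    integral_const_mul, hD.integral_eq_zero]
  simp

theorem variance_affine (hD : IsSymmetricNoise v D) (c d : ℝ) :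
    variance (fun y : ℝ => y) (D.map fun y => c + d * y)
      = d ^ 2 * variance (fun y : ℝ => y) D := by
  have := hD.prob
  rw [variance_map (by fun_prop) (by fun_prop)]
  change variance (fun y : ℝ => c + d * y) D = _
  rw [variance_const_add (by fun_prop), variance_const_mul]

theorem lintegral_exp_le (hD : IsSymmetricNoise v D) (t : ℝ) :
    ∫⁻ y, ENNReal.ofReal (Real.exp (t * y)) ∂D ≤ ENNReal.ofReal (Real.exp (t ^ 2 / 2)) := by
  have := hD.prob
  -- Hoeffding's lemma on [-1, 1], where the variance proxy is (2/2)² = 1.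
  have h := hasSubgaussianMGF_of_mem_Icc_of_integral_eq_zero (X := fun y : ℝ => y)
    aemeasurable_id hD.ae_mem hD.integral_eq_zero
  rw [← ofReal_integral_eq_lintegral_ofReal (h.integrable_exp_mul t)
    (Filter.Eventually.of_forall fun y => (Real.exp_pos _).le)]
  refine ENNReal.ofReal_le_ofReal ((h.mgf_le t).trans_eq ?_)
  congr 1
  have h2 : (‖(1 : ℝ) - -1‖₊ / 2) ^ 2 = 1 := by
    ext; push_cast; norm_num
  rw [h2]; norm_num

end IsSymmetricNoise

/-! ### Values and gaps of the hard instance -/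

section HardInstance

variable {S : ℕ} {hS : 1 ≤ S} {ε : ℝ} {h0 : 0 < ε} {h1 : ε < 1 / 8} {v : ℝ} {D : Measure ℝ}
  {hD : IsSymmetricNoise v D} {q : HardState S → HardState S → ℝ}
  {hq : ∀ x, q x ∈ stdSimplex ℝ (HardState S)}

theorem hardState_eq_origin {x : HardState S} : x = hardOrigin S ↔ (x : ℤ) = 0 :=
  Subtype.ext_iff

theorem card_hardState : Fintype.card (HardState S) = 2 * S + 1 := by
  rw [Fintype.card_coe, Int.card_Icc]; omega

theorem sum_hardTransition_origin (hS : 1 ≤ S) (q : HardState S → HardState S → ℝ) (a : ℤˣ)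
    {f : HardState S → ℝ} {c : ℝ} (hf : ∀ x : HardState S, 0 < (a : ℤ) * (x : ℤ) → f x = c) :
    ∑ x', hardTransition S q (hardOrigin S) a x' * f x' = c := by
  have hz : ((hardOrigin S : HardState S) : ℤ) = 0 := rfl
  have : ∀ x', hardTransition S q (hardOrigin S) a x' * f x'
      = if 0 < (a : ℤ) * (x' : ℤ) then 1 / (S : ℝ) * c else 0 := by
    intro x'
    unfold hardTransition
    rw [if_pos hz]
    split_ifs with h
    · rw [hf x' h]
    · rw [zero_mul]
  rw [Finset.sum_congr rfl fun x' _ => this x', ← Finset.sum_filter, Finset.sum_const,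
    card_hard_side, nsmul_eq_mul]
  have : (S : ℝ) ≠ 0 := by positivity
  field_simp

local notation "hM" => hardMDP S hS ε h0 h1 D hD q hq

theorem hardMDP_r_neg_one (x : HardState S) : (hM).r x (-1) = 0 := by
  simp [MDP.r, hardMDP, hardReward]

theorem hardMDP_r_origin (a : ℤˣ) : (hM).r (hardOrigin S) a = 0 := by
  simp [MDP.r, hardMDP, hardReward, hardOrigin]

theorem hardReward_negative {x : HardState S} (hx : (x : ℤ) < 0) :
    hardReward S ε D x 1 = D.map (fun y => 1 / 2 + 1 / 4 * y) := by
  have h2 : ¬((x : ℤ) = 0 ∨ (1 : ℤˣ) = -1) := by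
    rintro (h | h)
    · omega
    · exact absurd h (by decide)
  rw [hardReward, if_neg h2, if_neg (by omega)]

theorem hardReward_positive {x : HardState S} (hx : 0 < (x : ℤ)) :
    hardReward S ε D x 1 = D.map (fun y => 1 / 2 + ε + 1 / 4 * y) := by
  have h2 : ¬((x : ℤ) = 0 ∨ (1 : ℤˣ) = -1) := by
    rintro (h | h)
    · omega
    · exact absurd h (by decide)
  rw [hardReward, if_neg h2, if_pos hx]

theorem hardMDP_r_negative {x : HardState S} (hx : (x : ℤ) < 0) : (hM).r x 1 = 1 / 2 := by
  change ∫ y, y ∂(hardReward S ε D x 1) = _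
  rw [hardReward_negative hx, hD.integral_affine]

theorem hardMDP_r_positive {x : HardState S} (hx : 0 < (x : ℤ)) : (hM).r x 1 = 1 / 2 + ε := by
  change ∫ y, y ∂(hardReward S ε D x 1) = _
  rw [hardReward_positive hx, hD.integral_affine]

theorem hardMDP_rewardVar_negative {x : HardState S} (hx : (x : ℤ) < 0) :
    v / 16 ≤ (hM).rewardVar x 1 := by
  change _ ≤ variance (fun y : ℝ => y) (hardReward S ε D x 1)
  rw [hardReward_negative hx, hD.variance_affine]
  linarith [hD.var]

theorem hardMDP_half_le_r {x : HardState S} (hx : (x : ℤ) ≠ 0) : 1 / 2 ≤ (hM).r x 1 := by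
  rcases lt_or_gt_of_ne hx with h | h
  · exact (hardMDP_r_negative h).ge
  · rw [hardMDP_r_positive h]; linarith

theorem hardMDP_r_one_nonneg (x : HardState S) : 0 ≤ (hM).r x 1 := by
  by_cases hx : (x : ℤ) = 0
  · rw [hardState_eq_origin.2 hx, hardMDP_r_origin]
  · linarith [hardMDP_half_le_r (hS := hS) (h0 := h0) (h1 := h1) (hD := hD) (hq := hq) hx]

theorem hardMDP_r_le (x : HardState S) (a : ℤˣ) : (hM).r x a ≤ (hM).r x 1 := by
  rcases Int.units_eq_one_or a with rfl | rfl
  · exact le_rfl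
  · rw [hardMDP_r_neg_one]; exact hardMDP_r_one_nonneg x

theorem hardMDP_value_two (π : ℕ → HardState S → ℤˣ) (x : HardState S) :
    (hM).value π 2 x = (hM).r x (π 2 x) := by
  change (hM).valueToGo π 1 x = _
  simp only [MDP.valueToGo, mul_zero, Finset.sum_const_zero, add_zero]
  rfl

theorem hardMDP_value_one (π : ℕ → HardState S → ℤˣ) (x : HardState S) :
    (hM).value π 1 x = (hM).r x (π 1 x)
      + ∑ x', hardTransition S q x (π 1 x) x' * (hM).r x' (π 2 x') := by
  change (hM).valueToGo π 2 x = _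
  simp only [MDP.valueToGo, mul_zero, Finset.sum_const_zero, add_zero]
  rfl

/-- The constant policy `1` is optimal at every stage and state, so each supremum over policies is
evaluated at it. -/
theorem hardMDP_optValue_eq {h : ℕ} {x : HardState S} {c : ℝ}
    (hc : (hM).value (fun _ _ => 1) h x = c) (hle : ∀ π, (hM).value π h x ≤ c) :
    (hM).optValue h x = c :=
  IsGreatest.csSup_eq ⟨⟨_, hc⟩, by rintro _ ⟨π, rfl⟩; exact hle π⟩

theorem hardMDP_optValue_three (x : HardState S) : (hM).optValue 3 x = 0 :=
  hardMDP_optValue_eq rfl fun _ => le_rfl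

theorem hardMDP_optValue_two (x : HardState S) : (hM).optValue 2 x = (hM).r x 1 :=
  hardMDP_optValue_eq (hardMDP_value_two _ x)
    fun π => (hardMDP_value_two π x).trans_le (hardMDP_r_le x _)

theorem sum_hardTransition_r_le (x : HardState S) (a : ℤˣ) (π : HardState S → ℤˣ) :
    ∑ x', hardTransition S q x a x' * (hM).r x' (π x')
      ≤ ∑ x', hardTransition S q x a x' * (hM).r x' 1 :=
  Finset.sum_le_sum fun x' _ => mul_le_mul_of_nonneg_left (hardMDP_r_le x' _)
    ((hardTransition_mem S hS q hq x a).1 x')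

theorem sum_hardTransition_r_one :
    ∑ x', hardTransition S q (hardOrigin S) 1 x' * (hM).r x' 1 = 1 / 2 + ε :=
  sum_hardTransition_origin hS q 1 fun x hx => hardMDP_r_positive (by simpa using hx)

theorem sum_hardTransition_r_neg_one :
    ∑ x', hardTransition S q (hardOrigin S) (-1) x' * (hM).r x' 1 = 1 / 2 :=
  sum_hardTransition_origin hS q (-1) fun x hx => hardMDP_r_negative (by simpa using hx)

theorem hardMDP_optValue_one_origin : (hM).optValue 1 (hardOrigin S) = 1 / 2 + ε := by
  refine hardMDP_optValue_eq ?_ fun π => ?_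
  · rw [hardMDP_value_one, hardMDP_r_origin, sum_hardTransition_r_one, zero_add]
  · rw [hardMDP_value_one, hardMDP_r_origin, zero_add]
    refine (sum_hardTransition_r_le _ _ _).trans ?_
    rcases Int.units_eq_one_or (π 1 (hardOrigin S)) with h | h <;> rw [h]
    · rw [sum_hardTransition_r_one]
    · rw [sum_hardTransition_r_neg_one]; linarith

theorem hardMDP_optValue_one {x : HardState S} (hx : (x : ℤ) ≠ 0) :
    (hM).optValue 1 x = (hM).r x 1 + ∑ x', q x x' * (hM).r x' 1 := by
  have hT : ∀ a x', hardTransition S q x a x' = q x x' := fun a x' => by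
    simp [hardTransition, hx]
  refine hardMDP_optValue_eq ?_ fun π => ?_
  · simp_rw [hardMDP_value_one, hT]
  · rw [hardMDP_value_one]
    have := sum_hardTransition_r_le (hS := hS) (h0 := h0) (h1 := h1) (hD := hD) (hq := hq) x
      (π 1 x) (π 2)
    simp_rw [hT] at this ⊢
    exact add_le_add (hardMDP_r_le x _) this

theorem hardMDP_gap_two (x : HardState S) (a : ℤˣ) :
    (hM).gap 2 x a = (hM).r x 1 - (hM).r x a := by
  simp only [MDP.gap, MDP.optQ, Nat.reduceAdd, hardMDP_optValue_two, hardMDP_optValue_three, mul_zero,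
    Finset.sum_const_zero, add_zero]

theorem hardMDP_gap_one {x : HardState S} (hx : (x : ℤ) ≠ 0) (a : ℤˣ) :
    (hM).gap 1 x a = (hM).r x 1 - (hM).r x a := by
  -- Away from the origin the transition ignores the action, so the future terms cancel and only the
  -- rewards are compared.
  have hT : ∀ x', (hM).p x a x' = q x x' := fun x' => by
    simp [hardMDP, hardTransition, hx]
  simp only [MDP.gap, MDP.optQ, Nat.reduceAdd, hardMDP_optValue_two, hardMDP_optValue_one hx, hT]
  ring

theorem hardMDP_gap_one_origin_one : (hM).gap 1 (hardOrigin S) 1 = 0 := by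
  simp only [MDP.gap, MDP.optQ, Nat.reduceAdd, hardMDP_optValue_two, hardMDP_optValue_one_origin,
    hardMDP_r_origin]
  rw [show (hM).p = hardTransition S q from rfl, sum_hardTransition_r_one]
  ring

theorem hardMDP_gap_one_origin_neg_one : (hM).gap 1 (hardOrigin S) (-1) = ε := by
  simp only [MDP.gap, MDP.optQ, Nat.reduceAdd, hardMDP_optValue_two, hardMDP_optValue_one_origin,
    hardMDP_r_origin]
  rw [show (hM).p = hardTransition S q from rfl, sum_hardTransition_r_neg_one]
  ring

theorem hardMDP_gap_eq {h : ℕ} (hh : h ∈ Finset.Icc 1 (hM).H) (x : HardState S) (a : ℤˣ)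
    (hne : h = 2 ∨ (x : ℤ) ≠ 0) : (hM).gap h x a = (hM).r x 1 - (hM).r x a := by
  have h2 : h ∈ Finset.Icc 1 2 := hh
  have h3 : h = 1 ∨ h = 2 := by rw [Finset.mem_Icc] at h2; omega
  rcases h3 with rfl | rfl
  · exact hardMDP_gap_one (hne.resolve_left (by norm_num)) a
  · exact hardMDP_gap_two x a

theorem hardMDP_gap_eq_zero {h : ℕ} (hh : h ∈ Finset.Icc 1 (hM).H) (x : HardState S) :
    (hM).gap h x 1 = 0 := by
  by_cases hne : h = 2 ∨ (x : ℤ) ≠ 0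
  · rw [hardMDP_gap_eq hh x 1 hne, sub_self]
  · push Not at hne
    have h2 : h ∈ Finset.Icc 1 2 := hh
    have h3 : h = 1 := by rw [Finset.mem_Icc] at h2; omega
    rw [h3, hardState_eq_origin.2 hne.2, hardMDP_gap_one_origin_one]

theorem hardMDP_half_le_gap {h : ℕ} (hh : h ∈ Finset.Icc 1 (hM).H) {x : HardState S}
    (hx : (x : ℤ) ≠ 0) : 1 / 2 ≤ (hM).gap h x (-1) := by
  rw [hardMDP_gap_eq hh x _ (Or.inr hx), hardMDP_r_neg_one, sub_zero]
  exact hardMDP_half_le_r hx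

theorem hardMDP_half_le_gap_of_pos {h : ℕ} (hh : h ∈ Finset.Icc 1 (hM).H) {x : HardState S}
    {a : ℤˣ} (hne : (h, x, a) ≠ (1, hardOrigin S, -1)) (hpos : 0 < (hM).gap h x a) :
    1 / 2 ≤ (hM).gap h x a := by
  rcases Int.units_eq_one_or a with rfl | rfl
  · rw [hardMDP_gap_eq_zero hh] at hpos; exact absurd hpos (lt_irrefl _)
  · by_cases hx : (x : ℤ) = 0
    · obtain rfl := hardState_eq_origin.2 hx
      have h2 : h ∈ Finset.Icc 1 2 := hh
      have h3 : h = 1 ∨ h = 2 := by rw [Finset.mem_Icc] at h2; omega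
      rcases h3 with rfl | rfl
      · exact absurd rfl hne
      · rw [hardMDP_gap_two, hardMDP_r_origin, hardMDP_r_origin, sub_zero] at hpos
        exact absurd hpos (lt_irrefl _)
    · exact hardMDP_half_le_gap hh hx

theorem hardMDP_isLeast_positiveGaps : IsLeast (hM).positiveGaps ε := by
  refine ⟨⟨1, Finset.mem_Icc.2 ⟨le_rfl, (hM).H_pos⟩, hardOrigin S, -1,
    hardMDP_gap_one_origin_neg_one, h0⟩, ?_⟩
  rintro _ ⟨h, hh, x, a, rfl, hpos⟩
  by_cases hne : (h, x, a) = (1, hardOrigin S, -1)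
  · obtain ⟨rfl, rfl, rfl⟩ : h = 1 ∧ x = hardOrigin S ∧ a = -1 := by simpa using hne
    exact hardMDP_gap_one_origin_neg_one.ge
  · linarith [hardMDP_half_le_gap_of_pos hh hne hpos]

theorem hardMDP_sumInvGaps_le : (hM).sumInvGaps ≤ 16 * ((S : ℝ) + 1 / ε) := by
  classical
  have hε : 0 < 1 / ε := by positivity
  -- A gap of at least 1/2 contributes at most 2. The pair `(0, -1)` is allowed 1/ε at both stages,
  -- although its gap vanishes at the second; the overcount is harmless.
  have hterm : ∀ h ∈ Finset.Icc 1 (hM).H, ∀ x a,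
      (if 0 < (hM).gap h x a then 1 / (hM).gap h x a else 0)
        ≤ (if (x, a) = (hardOrigin S, (-1 : ℤˣ)) then 1 / ε else 0) + 2 := by
    intro h hh x a
    have hsp : (0 : ℝ) ≤ if (x, a) = (hardOrigin S, (-1 : ℤˣ)) then 1 / ε else 0 := by
      split_ifs <;> positivity
    split_ifs with hpos heq heq
    · obtain ⟨rfl, rfl⟩ : x = hardOrigin S ∧ a = -1 := by simpa using heq
      have := hardMDP_isLeast_positiveGaps (hS := hS) (h0 := h0) (h1 := h1) (hD := hD)
        (hq := hq)
      have h3 := one_div_le_one_div_of_le h0 (this.2 ⟨h, hh, _, _, rfl, hpos⟩)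
      linarith
    · have h2 := hardMDP_half_le_gap_of_pos hh (fun h => heq (Prod.ext_iff.1 h).2) hpos
      have h3 := one_div_le_one_div_of_le (by norm_num) h2
      norm_num at h3 ⊢
      linarith
    · linarith
    · norm_num
  have hsum : ∑ x : HardState S, ∑ a : ℤˣ,
      ((if (x, a) = (hardOrigin S, (-1 : ℤˣ)) then 1 / ε else 0) + 2)
        = 1 / ε + 4 * (2 * (S : ℝ) + 1) := by
    rw [← Fintype.sum_prod_type'
      (f := fun x a => (if (x, a) = (hardOrigin S, (-1 : ℤˣ)) then 1 / ε else 0) + 2),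
      Finset.sum_add_distrib, Finset.sum_ite_eq' Finset.univ (hardOrigin S, (-1 : ℤˣ))]
    simp only [Finset.mem_univ, if_true, Finset.sum_const, Finset.card_univ, Fintype.card_prod,
      card_hardState, Fintype.card_units_int, nsmul_eq_mul]
    push_cast
    ring
  have hS' : (1 : ℝ) ≤ S := by exact_mod_cast hS
  calc (hM).sumInvGaps
      ≤ ∑ h ∈ Finset.Icc 1 (hM).H, ∑ x : HardState S, ∑ a : ℤˣ,
        ((if (x, a) = (hardOrigin S, (-1 : ℤˣ)) then 1 / ε else 0) + 2) := by
        unfold MDP.sumInvGaps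
        exact Finset.sum_le_sum fun h hh => Finset.sum_le_sum fun x _ =>
          Finset.sum_le_sum fun a _ => by convert hterm h hh x a
    _ = 2 * (1 / ε + 4 * (2 * (S : ℝ) + 1)) := by
        rw [hsum, Finset.sum_const, nsmul_eq_mul]
        have : (Finset.Icc 1 (hM).H).card = 2 := by change (Finset.Icc 1 2).card = 2; simp
        rw [this]; norm_num
    _ ≤ _ := by
        -- The sum so far is 2/ε + 16S + 8, and the 8 is absorbed into 1/ε.
        have : 8 < 1 / ε := by rw [lt_div_iff₀ h0]; linarith
        linarith

/-! ### The cost of a wrong first action -/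

theorem hardMDP_optValue0 : (hM).optValue0 = 1 / 2 + ε := by
  have hv : ∀ π, (hM).value0 π = (hM).value π 1 (hardOrigin S) := fun π => by
    change ∑ x, (Pi.single (hardOrigin S) 1 : HardState S → ℝ) x * _ = _
    simp [Pi.single_apply]
  unfold MDP.optValue0
  simp_rw [hv]
  exact hardMDP_optValue_one_origin

theorem hardMDP_value0_le (π : ℕ → HardState S → ℤˣ) :
    (hM).value0 π ≤ 1 / 2 + ε - if π 1 (hardOrigin S) = -1 then ε else 0 := by
  have hv : (hM).value0 π = (hM).value π 1 (hardOrigin S) := by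
    change ∑ x, (Pi.single (hardOrigin S) 1 : HardState S → ℝ) x * _ = _
    simp [Pi.single_apply]
  rw [hv, hardMDP_value_one, hardMDP_r_origin, zero_add]
  refine (sum_hardTransition_r_le _ _ _).trans ?_
  rcases Int.units_eq_one_or (π 1 (hardOrigin S)) with h | h <;> rw [h]
  · rw [sum_hardTransition_r_one, if_neg (by decide)]; linarith
  · rw [sum_hardTransition_r_neg_one, if_pos rfl]; linarith

/-- The centred reward is a quarter of the noise, hence has variance proxy 1/16, which l²/32
compensates exactly. -/
theorem lintegral_exp_hardReward_le (hD : IsSymmetricNoise v D) {x : HardState S}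
    (hx : (x : ℤ) < 0) (l : ℝ) :
    ∫⁻ y, ENNReal.ofReal (Real.exp (-l * (y - 1 / 2) - l ^ 2 / 32)) ∂(hardReward S ε D x 1)
      ≤ 1 := by
  rw [hardReward_negative hx, lintegral_map (by fun_prop) (by fun_prop)]
  have h2 : ∀ y : ℝ, ENNReal.ofReal (Real.exp (-l * (1 / 2 + 1 / 4 * y - 1 / 2) - l ^ 2 / 32))
      = ENNReal.ofReal (Real.exp (-(l ^ 2 / 32))) * ENNReal.ofReal (Real.exp (-l / 4 * y)) := by
    intro y
    rw [← ENNReal.ofReal_mul (Real.exp_pos _).le, ← Real.exp_add]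
    congr 2; ring
  simp_rw [h2]
  rw [lintegral_const_mul _ (by fun_prop)]
  refine (mul_le_mul_right (hD.lintegral_exp_le (-l / 4)) _).trans ?_
  rw [← ENNReal.ofReal_mul (Real.exp_pos _).le, ← Real.exp_add]
  have : -(l ^ 2 / 32) + (-l / 4) ^ 2 / 2 = 0 := by ring
  rw [this]; simp

end HardInstance

/-! ### Counting along a trajectory in the hard instance -/

/-- The negative states. -/
noncomputable def negStates (S : ℕ) : Finset (HardState S) :=
  Finset.univ.filter fun x => (x : ℤ) < 0

theorem mem_negStates {S : ℕ} {x : HardState S} : x ∈ negStates S ↔ (x : ℤ) < 0 := by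
  simp [negStates]

theorem card_negStates {S : ℕ} : (negStates S).card = S := by
  simpa [negStates] using card_hard_side S (-1)

namespace Interaction

theorem sum_visits {A B : Type} {Ω : Type*} [DecidableEq A] [DecidableEq B]
    (τ : Interaction A B Ω) (K : ℕ) (x : A) (a : B) (ω : Ω) {E : Type*} [AddCommMonoid E]
    (f : ℕ × ℕ → E) :
    ∑ i ∈ τ.visits 2 K x a ω, f i = ∑ k ∈ Finset.range K,
      ((if τ.state k 1 ω = x ∧ τ.action k 1 ω = a then f (k, 1) else 0)
        + if τ.state k 2 ω = x ∧ τ.action k 2 ω = a then f (k, 2) else 0) := by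
  unfold visits
  rw [Finset.sum_filter, Finset.sum_product]
  refine Finset.sum_congr rfl fun k _ => ?_
  rw [Finset.sum_Icc_succ_top (by norm_num), Finset.Icc_self, Finset.sum_singleton]
  congr

variable {S : ℕ} {Ω : Type*} (τ : Interaction (HardState S) ℤˣ Ω)

/-- The number of the first `K` episodes in which `-1` was played at the start. -/
def wrongCount (K : ℕ) (ω : Ω) : ℕ :=
  ((Finset.range K).filter fun k => τ.action k 1 ω = -1).card

/-- The number of the first `K` episodes that reached `x` at the last stage. -/
def endCount (K : ℕ) (x : HardState S) (ω : Ω) : ℕ :=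
  ((Finset.range K).filter fun k => τ.state k 2 ω = x).card

/-- The number of the first `K` episodes with action `1` in a negative state at the last stage. -/
def noiseCount (K : ℕ) (ω : Ω) : ℕ :=
  ((Finset.range K).filter fun k => (τ.state k 2 ω : ℤ) < 0 ∧ τ.action k 2 ω = 1).card

/-- The sum of the centred rewards over the episodes counted by `noiseCount`. -/
noncomputable def noiseSum (K : ℕ) (ω : Ω) : ℝ :=
  ∑ k ∈ Finset.range K,
    if (τ.state k 2 ω : ℤ) < 0 ∧ τ.action k 2 ω = 1 then τ.reward k 2 ω - 1 / 2 else 0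

end Interaction

/-- The properties that almost every trajectory in the hard instance has. -/
structure IsHardPath {S : ℕ} {Ω : Type*} (τ : Interaction (HardState S) ℤˣ Ω) (ω : Ω) :
    Prop where
  init : ∀ k, τ.state k 1 ω = hardOrigin S
  side : ∀ k, 0 < (τ.action k 1 ω : ℤ) * (τ.state k 2 ω : ℤ)
  reward : ∀ k, τ.action k 2 ω = -1 → τ.reward k 2 ω = 0

namespace IsHardPath

variable {S : ℕ} {Ω : Type*} {τ : Interaction (HardState S) ℤˣ Ω} {ω : Ω}

/-- Together with `init` this separates the stages: the origin occurs only at stage 1 and the other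
states only at stage 2, so each count over both stages reduces to one of them. -/
theorem state_ne (hp : IsHardPath τ ω) (k : ℕ) : (τ.state k 2 ω : ℤ) ≠ 0 := fun h => by
  have := hp.side k
  rw [h, mul_zero] at this
  exact lt_irrefl _ this

theorem action_eq_iff (hp : IsHardPath τ ω) (k : ℕ) :
    τ.action k 1 ω = -1 ↔ (τ.state k 2 ω : ℤ) < 0 := by
  have := hp.side k
  rcases Int.units_eq_one_or (τ.action k 1 ω) with h | h <;> rw [h] at this ⊢
  · simp only [Units.val_one, one_mul] at this
    constructor
    · intro h; exact absurd h (by decide)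
    · intro h; omega
  · simpa using this

theorem count_origin (hp : IsHardPath τ ω) (K : ℕ) :
    τ.count 2 K (hardOrigin S) (-1) ω = τ.wrongCount K ω := by
  unfold Interaction.count Interaction.wrongCount
  rw [Finset.card_eq_sum_ones, τ.sum_visits, Finset.card_filter]
  refine Finset.sum_congr rfl fun k _ => ?_
  have := hp.state_ne k
  simp [hp.init k, hardState_eq_origin, this]

theorem countNext_origin_of_neg (hp : IsHardPath τ ω) (K : ℕ) {x : HardState S}
    (hx : (x : ℤ) < 0) : τ.countNext 2 K (hardOrigin S) (-1) x ω = τ.endCount K x ω := by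
  classical
  unfold Interaction.countNext Interaction.endCount
  rw [Finset.card_filter, τ.sum_visits, Finset.card_filter]
  refine Finset.sum_congr rfl fun k _ => ?_
  have := hp.state_ne k
  simp only [hp.init k, hardState_eq_origin, this, false_and, if_false, add_zero, true_and,
    hp.action_eq_iff k]
  by_cases h : τ.state k 2 ω = x
  · simp [h, hx]
  · simp [h]

theorem countNext_origin_of_nonneg (hp : IsHardPath τ ω) (K : ℕ) {x : HardState S}
    (hx : 0 ≤ (x : ℤ)) : τ.countNext 2 K (hardOrigin S) (-1) x ω = 0 := by
  classical
  unfold Interaction.countNext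
  rw [Finset.card_filter, τ.sum_visits]
  refine Finset.sum_eq_zero fun k _ => ?_
  have := hp.state_ne k
  simp only [hp.init k, hardState_eq_origin, this, false_and, if_false, add_zero,
    hp.action_eq_iff k]
  by_cases h : τ.state k 2 ω = x
  · simp [h, not_lt.2 hx]
  · simp [h]

theorem count_eq (hp : IsHardPath τ ω) (K : ℕ) {x : HardState S} (hx : (x : ℤ) ≠ 0) (a : ℤˣ) :
    τ.count 2 K x a ω
      = ((Finset.range K).filter fun k => τ.state k 2 ω = x ∧ τ.action k 2 ω = a).card := by
  unfold Interaction.count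
  rw [Finset.card_eq_sum_ones, τ.sum_visits, Finset.card_filter]
  refine Finset.sum_congr rfl fun k _ => ?_
  have : ¬ hardOrigin S = x := fun h => hx (hardState_eq_origin.1 h.symm)
  simp [hp.init k, this]

theorem count_add_count (hp : IsHardPath τ ω) (K : ℕ) {x : HardState S} (hx : (x : ℤ) ≠ 0) :
    τ.count 2 K x 1 ω + τ.count 2 K x (-1) ω = τ.endCount K x ω := by
  rw [hp.count_eq K hx, hp.count_eq K hx, Interaction.endCount, Finset.card_filter,
    Finset.card_filter, Finset.card_filter, ← Finset.sum_add_distrib]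
  refine Finset.sum_congr rfl fun k _ => ?_
  rcases Int.units_eq_one_or (τ.action k 2 ω) with h | h <;> simp [h]

theorem rhat_neg_one (hp : IsHardPath τ ω) (K : ℕ) {x : HardState S} (hx : (x : ℤ) ≠ 0) :
    τ.rhat 2 K x (-1) ω = 0 := by
  unfold Interaction.rhat
  rw [τ.sum_visits, Finset.sum_eq_zero, zero_div]
  intro k _
  have : ¬ hardOrigin S = x := fun h => hx (hardState_eq_origin.1 h.symm)
  simp only [hp.init k, this, false_and, if_false, zero_add, ite_eq_right_iff]
  exact fun h => hp.reward k h.2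

theorem sum_endCount (hp : IsHardPath τ ω) (K : ℕ) :
    ∑ x ∈ negStates S, τ.endCount K x ω = τ.wrongCount K ω := by
  unfold Interaction.endCount Interaction.wrongCount
  simp_rw [Finset.card_filter]
  rw [Finset.sum_comm]
  refine Finset.sum_congr rfl fun k _ => ?_
  simp [hp.action_eq_iff k, mem_negStates]

theorem count_mul_rhat (hp : IsHardPath τ ω) (K : ℕ) {x : HardState S} (hx : (x : ℤ) ≠ 0) :
    (τ.count 2 K x 1 ω : ℝ) * (τ.rhat 2 K x 1 ω - 1 / 2)
      = ∑ k ∈ Finset.range K,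
        if τ.state k 2 ω = x ∧ τ.action k 2 ω = 1 then τ.reward k 2 ω - 1 / 2 else 0 := by
  have h1 : (τ.count 2 K x 1 ω : ℝ) * τ.rhat 2 K x 1 ω
      = ∑ i ∈ τ.visits 2 K x 1 ω, τ.reward i.1 i.2 ω := by
    unfold Interaction.rhat Interaction.count
    -- Without visits the empirical mean is 0/0 = 0, and both sides vanish.
    by_cases hc : (τ.visits 2 K x 1 ω).card = 0
    · rw [Finset.card_eq_zero.1 hc]; simp
    · have : ((τ.visits 2 K x 1 ω).card : ℝ) ≠ 0 := by exact_mod_cast hc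
      field_simp
  have h2 : (τ.count 2 K x 1 ω : ℝ) * (1 / 2) = ∑ i ∈ τ.visits 2 K x 1 ω, (1 / 2 : ℝ) := by
    rw [Finset.sum_const, nsmul_eq_mul]; rfl
  rw [mul_sub, h1, h2, ← Finset.sum_sub_distrib, τ.sum_visits]
  refine Finset.sum_congr rfl fun k _ => ?_
  have : ¬ hardOrigin S = x := fun h => hx (hardState_eq_origin.1 h.symm)
  simp [hp.init k, this]

/-- Weighting by the counts removes the random denominators of the empirical means, so the errors of
all negative states merge into one martingale sum. -/
theorem sum_count_mul_rhat (hp : IsHardPath τ ω) (K : ℕ) :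
    ∑ x ∈ negStates S,
      (τ.count 2 K x 1 ω : ℝ) * (τ.rhat 2 K x 1 ω - 1 / 2) = τ.noiseSum K ω := by
  rw [Finset.sum_congr rfl fun x hx => hp.count_mul_rhat K (mem_negStates.1 hx).ne]
  rw [Finset.sum_comm]
  refine Finset.sum_congr rfl fun k _ => ?_
  by_cases h : τ.action k 2 ω = 1 <;> simp [h, mem_negStates]

theorem noiseCount_le (hp : IsHardPath τ ω) (K : ℕ) :
    τ.noiseCount K ω ≤ τ.wrongCount K ω := by
  refine Finset.card_le_card fun k hk => ?_
  rw [Finset.mem_filter] at hk ⊢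
  exact ⟨hk.1, (hp.action_eq_iff k).2 hk.2.1⟩

end IsHardPath

/-! ### The optimistic Q-function along a trajectory -/

section OptimisticPath

variable {S : ℕ} {Ω : Type*} {τ : Interaction (HardState S) ℤˣ Ω} {ω : Ω}
  {b : Bonuses (HardState S) ℤˣ Ω}

theorem Bonuses.optQ_two (k : ℕ) (x : HardState S) (a : ℤˣ) :
    b.optQ τ 2 k 2 x a ω = τ.rhat 2 k x a ω + b.rew k x a ω := rfl

/-- The maximum over the last action is replaced by its value at `1`, which is legitimate for
nonnegative weights. -/
theorem Bonuses.optQ_one_ge (k : ℕ) (x : HardState S) (a : ℤˣ)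
    (hphat : ∀ x', 0 ≤ b.phat τ 2 k x a x' ω) :
    τ.rhat 2 k x a ω + b.rew k x a ω
      + ∑ x', b.phat τ 2 k x a x' ω * (τ.rhat 2 k x' 1 ω + b.rew k x' 1 ω)
      + b.stage k 1 x a ω ≤ b.optQ τ 2 k 1 x a ω := by
  change _ ≤ τ.rhat 2 k x a ω + b.rew k x a ω
      + ∑ x', b.phat τ 2 k x a x' ω * (⨆ a', b.optQAux τ 2 k ω 0 x' a') + b.stage k 1 x a ω
  gcongr with x' _
  · exact hphat x'
  · exact le_ciSup (f := fun a' => b.optQAux τ 2 k ω 0 x' a') (Set.finite_range _).bddAbove 1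

/-- Once `(x, -1)` has been visited often, optimism at `(x, 1)` rules out further visits. -/
theorem le_of_half_le_bonus {c n L : ℝ} (hc : 0 < c) (hn : 1 ≤ n) (hL : 0 < L)
    (h : 1 / 2 ≤ c * Real.sqrt (Real.log (L * n) / n)) :
    n ≤ 8 * c ^ 2 * (Real.log L + 8 * c ^ 2) := by
  have hn0 : 0 < n := by linarith
  have hs : 0 ≤ Real.log (L * n) / n := by
    by_contra hneg
    rw [Real.sqrt_eq_zero_of_nonpos (not_le.1 hneg).le] at h
    linarith
  have h1 : (1 / 2) ^ 2 ≤ (c * Real.sqrt (Real.log (L * n) / n)) ^ 2 :=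
    pow_le_pow_left₀ (by norm_num) h 2
  rw [mul_pow, Real.sq_sqrt hs, ← mul_div_assoc, le_div_iff₀ hn0,
    Real.log_mul hL.ne' hn0.ne'] at h1
  have h8 : 0 < 8 * c ^ 2 := by positivity
  -- Apply log t ≤ t - 1 to both factors of n = (n / 8c²) · 8c²; the scale 8c² lets half of n absorb
  -- the logarithm below.
  have h2 : Real.log n ≤ n / (8 * c ^ 2) + 8 * c ^ 2 := by
    have h3 := Real.log_le_sub_one_of_pos (div_pos hn0 h8)
    have h4 := Real.log_le_sub_one_of_pos h8
    rw [Real.log_div hn0.ne' h8.ne'] at h3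
    linarith
  have h5 : 4 * c ^ 2 * Real.log n ≤ n / 2 + 4 * c ^ 2 * (8 * c ^ 2) := by
    have := mul_le_mul_of_nonneg_left h2 (by positivity : 0 ≤ 4 * c ^ 2)
    have h6 : 4 * c ^ 2 * (n / (8 * c ^ 2)) = n / 2 := by field_simp; norm_num
    linarith
  linarith

/-- Action `-1` always pays 0 in x, so its optimistic value is its bonus alone, while by correctness
that of action `1` is at least 1/2. Greedy play of `-1` thus needs a bonus of at least 1/2, which
caps the count before the visit; the visit itself adds 1. -/
theorem count_neg_one_le {cbar δ : ℝ} (hc : 0 < cbar) (hS : 1 ≤ S) (hδ : 0 < δ)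
    (hδ8 : δ < 1 / 8) (hp : IsHardPath τ ω)
    (hgreedy : ∀ k x a, b.optQ τ 2 k 2 x a ω ≤ b.optQ τ 2 k 2 x (τ.policy k ω 2 x) ω)
    (hupper : ∀ k x a, b.rew k x a ω ≤ cbar * Real.sqrt
      (Real.log (((Fintype.card (HardState S) * Fintype.card ℤˣ * 2 : ℕ) : ℝ)
          * max 1 (τ.count 2 k x a ω : ℝ) / δ)
        / max 1 (τ.count 2 k x a ω : ℝ)))
    {x : HardState S} (hx : (x : ℤ) ≠ 0)
    (hcorrect : ∀ k, 1 / 2 ≤ b.rew k x 1 ω + τ.rhat 2 k x 1 ω) (K : ℕ) :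
    (τ.count 2 K x (-1) ω : ℝ)
      ≤ (8 * cbar ^ 2 * (3 + 8 * cbar ^ 2) + 1) * Real.log ((S : ℝ) / δ) := by
  have hS' : (1 : ℝ) ≤ S := by exact_mod_cast hS
  have hSδ : 8 ≤ (S : ℝ) / δ := by rw [le_div_iff₀ hδ]; linarith
  have hlog8 : 2 ≤ Real.log 8 := by
    rw [show (8 : ℝ) = 2 ^ 3 by norm_num, Real.log_pow]
    have := Real.log_two_gt_d9
    push_cast; linarith
  have hlog : Real.log 8 ≤ Real.log ((S : ℝ) / δ) := Real.log_le_log (by norm_num) hSδ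
  have hℓ : 1 ≤ Real.log ((S : ℝ) / δ) := by linarith
  induction K with
  | zero =>
    rw [hp.count_eq 0 hx]
    simp only [Finset.range_zero, Finset.filter_empty, Finset.card_empty, Nat.cast_zero]
    positivity
  | succ K ih =>
    by_cases hv : τ.state K 2 ω = x ∧ τ.action K 2 ω = -1
    · have hle : (τ.count 2 (K + 1) x (-1) ω : ℝ) ≤ τ.count 2 K x (-1) ω + 1 := by
        rw [hp.count_eq _ hx, hp.count_eq _ hx, Finset.range_add_one, Finset.filter_insert,
          if_pos hv]
        exact_mod_cast Finset.card_insert_le _ _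
      set n : ℝ := max 1 (τ.count 2 K x (-1) ω : ℝ) with hn
      have hpol : τ.policy K ω 2 x = -1 := by rw [← hv.1]; exact hv.2
      have hg := hgreedy K x 1
      rw [hpol, Bonuses.optQ_two, Bonuses.optQ_two, hp.rhat_neg_one K hx] at hg
      have hu := hupper K x (-1)
      rw [← hn, card_hardState, Fintype.card_units_int, mul_div_right_comm] at hu
      have hb := le_of_half_le_bonus (n := n) hc (le_max_left _ _)
        (L := (((2 * S + 1) * 2 * 2 : ℕ) : ℝ) / δ) (by positivity)
        (by linarith [hcorrect K])
      -- Here 8S + 4 ≤ 8²S, and log 8 ≤ log(S/δ), so the factor 8² costs two further copies of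
      -- log(S/δ).
      have hL : Real.log ((((2 * S + 1) * 2 * 2 : ℕ) : ℝ) / δ)
          ≤ 3 * Real.log ((S : ℝ) / δ) := by
        have h1 : (((2 * S + 1) * 2 * 2 : ℕ) : ℝ) / δ ≤ 8 ^ 2 * ((S : ℝ) / δ) := by
          rw [← mul_div_assoc]
          gcongr
          push_cast; linarith
        refine (Real.log_le_log (by positivity) h1).trans ?_
        rw [Real.log_mul (by norm_num) (by positivity), Real.log_pow]
        push_cast; linarith
      have h2 : 8 * cbar ^ 2 * (Real.log ((((2 * S + 1) * 2 * 2 : ℕ) : ℝ) / δ) + 8 * cbar ^ 2)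
          ≤ 8 * cbar ^ 2 * ((3 + 8 * cbar ^ 2) * Real.log ((S : ℝ) / δ)) := by
        refine mul_le_mul_of_nonneg_left ?_ (by positivity)
        have := mul_le_mul_of_nonneg_left hℓ (by positivity : 0 ≤ 8 * cbar ^ 2)
        linarith
      have h3 : (τ.count 2 K x (-1) ω : ℝ) ≤ n := le_max_right _ _
      linarith
    · have heq : τ.count 2 (K + 1) x (-1) ω = τ.count 2 K x (-1) ω := by
        rw [hp.count_eq _ hx, hp.count_eq _ hx, Finset.range_add_one, Finset.filter_insert,
          if_neg hv]
      rw [heq]; exact ih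

/-- Optimism yields the value 1/2 only at states other than the origin, where all rewards are 0. The
estimated transition must therefore not charge the origin, even before the first visit. -/
theorem phat_origin_of_nonneg {K : ℕ} (hp : IsHardPath τ ω) {q : HardState S → HardState S → ℝ}
    (hinit : ∀ x', hardTransition S q (hardOrigin S) (-1) x' = 0 →
      b.phatInit K (hardOrigin S) (-1) x' ω = 0) {x : HardState S} (hx : 0 ≤ (x : ℤ)) :
    b.phat τ 2 K (hardOrigin S) (-1) x ω = 0 := by
  unfold Bonuses.phat
  split_ifs
  · refine hinit x ?_
    simp [hardTransition, hardOrigin, hx]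
  · rw [hp.countNext_origin_of_nonneg K hx]; simp

theorem phat_mem {K : ℕ} {x : HardState S} {a : ℤˣ}
    (hinit : (fun x' => b.phatInit K x a x' ω) ∈ stdSimplex ℝ (HardState S)) :
    (fun x' => b.phat τ 2 K x a x' ω) ∈ stdSimplex ℝ (HardState S) := by
  unfold Bonuses.phat
  split_ifs with hc
  · exact hinit
  · refine ⟨fun x' => by positivity, ?_⟩
    have hc' : (τ.count 2 K x a ω : ℝ) ≠ 0 := by exact_mod_cast hc
    rw [← Finset.sum_div, div_eq_one_iff_eq hc', ← Nat.cast_sum]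
    congr 1
    unfold Interaction.countNext Interaction.count
    rw [Finset.card_eq_sum_card_fiberwise (s := τ.visits 2 K x a ω) (t := Finset.univ)
      (f := fun i : ℕ × ℕ => τ.state i.1 (i.2 + 1) ω)
      fun _ _ => Finset.mem_coe.2 (Finset.mem_univ _)]
    refine Finset.sum_congr rfl fun x' _ => ?_
    congr

/-- Optimism alone: the estimated value of the wrong action exceeds its true value by the
transition bonus. -/
theorem optQ_one_neg_one_ge {K : ℕ} {cbon : ℝ} (hp : IsHardPath τ ω)
    {q : HardState S → HardState S → ℝ}
    (hinit : (fun x' => b.phatInit K (hardOrigin S) (-1) x' ω) ∈ stdSimplex ℝ (HardState S))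
    (hinit0 : ∀ x', hardTransition S q (hardOrigin S) (-1) x' = 0 →
      b.phatInit K (hardOrigin S) (-1) x' ω = 0)
    (hstage : cbon / max 1 (τ.count 2 K (hardOrigin S) (-1) ω : ℝ)
      ≤ b.stage K 1 (hardOrigin S) (-1) ω)
    (horigin : 0 ≤ b.rew K (hardOrigin S) (-1) ω + τ.rhat 2 K (hardOrigin S) (-1) ω)
    (hcorrect : ∀ x : HardState S, (x : ℤ) ≠ 0 → 1 / 2 ≤ b.rew K x 1 ω + τ.rhat 2 K x 1 ω) :
    1 / 2 + cbon / max 1 (τ.wrongCount K ω : ℝ) ≤ b.optQ τ 2 K 1 (hardOrigin S) (-1) ω := by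
  have hm := phat_mem (τ := τ) hinit
  refine le_trans ?_ (Bonuses.optQ_one_ge K _ _ fun x' => hm.1 x')
  rw [hp.count_origin K] at hstage
  have : (1 / 2 : ℝ) ≤ ∑ x', b.phat τ 2 K (hardOrigin S) (-1) x' ω
      * (τ.rhat 2 K x' 1 ω + b.rew K x' 1 ω) := by
    calc (1 / 2 : ℝ) = ∑ x', b.phat τ 2 K (hardOrigin S) (-1) x' ω * (1 / 2) := by
          rw [← Finset.sum_mul, hm.2, one_mul]
      _ ≤ _ := by
          refine Finset.sum_le_sum fun x' _ => ?_
          by_cases hx : (x' : ℤ) = 0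
          · rw [phat_origin_of_nonneg hp hinit0 hx.ge]; simp
          · exact mul_le_mul_of_nonneg_left (by linarith [hcorrect x' hx]) (hm.1 x')
  linarith

/-- The estimated value of the wrong action exceeds its true value by the average of the noise
and of the reward bonuses. -/
theorem noiseSum_add_bonus_le {K : ℕ} (hp : IsHardPath τ ω)
    (hN : τ.wrongCount K ω ≠ 0)
    (hstage : 0 ≤ b.stage K 1 (hardOrigin S) (-1) ω)
    (horigin : 0 ≤ b.rew K (hardOrigin S) (-1) ω + τ.rhat 2 K (hardOrigin S) (-1) ω)
    (hcorrect : ∀ x : HardState S, (x : ℤ) ≠ 0 → 1 / 2 ≤ b.rew K x 1 ω + τ.rhat 2 K x 1 ω) :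
    τ.noiseSum K ω
        + ∑ x ∈ negStates S, (τ.count 2 K x 1 ω : ℝ) * b.rew K x 1 ω
      ≤ (b.optQ τ 2 K 1 (hardOrigin S) (-1) ω - 1 / 2) * τ.wrongCount K ω := by
  have hN0 : (0 : ℝ) < τ.wrongCount K ω := by
    exact_mod_cast Nat.pos_of_ne_zero hN
  have hphat : ∀ x, b.phat τ 2 K (hardOrigin S) (-1) x ω
      = (if (x : ℤ) < 0 then (τ.endCount K x ω : ℝ) else 0) / τ.wrongCount K ω := by
    intro x
    unfold Bonuses.phat
    rw [hp.count_origin, if_neg hN]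
    split_ifs with hx
    · rw [hp.countNext_origin_of_neg K hx]
    · rw [hp.countNext_origin_of_nonneg K (not_lt.1 hx), Nat.cast_zero]
  have hge := Bonuses.optQ_one_ge (τ := τ) (b := b) (ω := ω) K (hardOrigin S) (-1) fun x => by
    rw [hphat]; positivity
  have hsum : (∑ x', b.phat τ 2 K (hardOrigin S) (-1) x' ω
      * (τ.rhat 2 K x' 1 ω + b.rew K x' 1 ω)) * τ.wrongCount K ω
      = ∑ x ∈ negStates S,
        (τ.endCount K x ω : ℝ) * (τ.rhat 2 K x 1 ω + b.rew K x 1 ω) := by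
    rw [Finset.sum_mul, negStates, Finset.sum_filter]
    refine Finset.sum_congr rfl fun x _ => ?_
    rw [hphat]
    split_ifs
    · field_simp
    · simp
  have hhalf : ∑ x ∈ negStates S, (τ.endCount K x ω : ℝ) * (1 / 2)
      = 1 / 2 * τ.wrongCount K ω := by
    rw [← Finset.sum_mul, ← hp.sum_endCount K]; push_cast; ring
  -- By correctness every state's optimistic excess over 1/2 is nonnegative, so replacing all visits
  -- of x by those with action `1` only decreases the sum. The latter are the weights that match the
  -- empirical means.
  have hcomp : ∑ x ∈ negStates S,
        ((τ.count 2 K x 1 ω : ℝ) * (τ.rhat 2 K x 1 ω - 1 / 2)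
          + (τ.count 2 K x 1 ω : ℝ) * b.rew K x 1 ω)
      ≤ ∑ x ∈ negStates S,
        ((τ.endCount K x ω : ℝ) * (τ.rhat 2 K x 1 ω + b.rew K x 1 ω)
          - (τ.endCount K x ω : ℝ) * (1 / 2)) := by
    refine Finset.sum_le_sum fun x hx => ?_
    have hx' := (mem_negStates.1 hx).ne
    have h1 : (τ.count 2 K x 1 ω : ℝ) ≤ τ.endCount K x ω := by
      rw [← hp.count_add_count K hx']; push_cast
      linarith [(Nat.cast_nonneg (τ.count 2 K x (-1) ω) : (0 : ℝ) ≤ _)]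
    have h2 := mul_le_mul_of_nonneg_right h1
      (by linarith [hcorrect x hx'] : 0 ≤ τ.rhat 2 K x 1 ω + b.rew K x 1 ω - 1 / 2)
    linarith
  rw [Finset.sum_add_distrib, Finset.sum_sub_distrib, hp.sum_count_mul_rhat, hhalf,
    ← hsum] at hcomp
  refine hcomp.trans ?_
  rw [← sub_mul]
  exact mul_le_mul_of_nonneg_right (by linarith) hN0.le

end OptimisticPath

/-! ### The numerical core -/

theorem sum_le_sqrt_mul_sum_sqrt {ι : Type*} (s : Finset ι) {m : ι → ℝ} {U : ℝ}
    (hm : ∀ i ∈ s, 0 ≤ m i) (hU : ∀ i ∈ s, m i ≤ U) :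
    ∑ i ∈ s, m i ≤ Real.sqrt U * ∑ i ∈ s, Real.sqrt (m i) := by
  rw [Finset.mul_sum]
  refine Finset.sum_le_sum fun i hi => ?_
  calc m i = Real.sqrt (m i) * Real.sqrt (m i) := (Real.mul_self_sqrt (hm i hi)).symm
    _ ≤ _ := mul_le_mul_of_nonneg_right (Real.sqrt_le_sqrt (hU i hi)) (Real.sqrt_nonneg _)

/-- Since no m_i exceeds 4N/S and their sum is at least N/2, Σ√m_i ≥ √(SN)/4. With T = √(SΛN) the
bonuses thus total at least κT. The constant κ²/16 is chosen so that the noise takes away at most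
κT/2. What remains gives κT ≤ 4εN, and squaring yields the bound. -/
theorem count_lower_bound {ι : Type*} (s : Finset ι) {m β : ι → ℝ} {c v Λ S N W ε : ℝ}
    (hc : 0 < c) (hv : 0 < v) (hΛ : 0 < Λ) (hS : 0 < S) (hN : 0 < N) (hε : 0 < ε)
    (hm : ∀ i ∈ s, 0 ≤ m i) (hU : ∀ i ∈ s, m i ≤ 4 * (N / S)) (hsum : N / 2 ≤ ∑ i ∈ s, m i)
    (hβ : ∀ i ∈ s, c * Real.sqrt v / 4 * Real.sqrt Λ * Real.sqrt (m i) ≤ m i * β i)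
    (hW : -(2 * Real.sqrt ((c * Real.sqrt v / 16) ^ 2 / 16 * S * Λ * N)) ≤ W)
    (hle : W + ∑ i ∈ s, m i * β i ≤ 2 * ε * N) :
    (c * Real.sqrt v / 16) ^ 2 / 16 * S / ε ^ 2 * Λ ≤ N := by
  set κ := c * Real.sqrt v / 16 with hκ
  have hκ0 : 0 < κ := by positivity
  set T := Real.sqrt (S * Λ * N) with hT
  have hT0 : 0 < T := Real.sqrt_pos.2 (by positivity)
  have hTsq : T ^ 2 = S * Λ * N := Real.sq_sqrt (by positivity)
  have h1 : Real.sqrt (κ ^ 2 / 16 * S * Λ * N) = κ / 4 * T := by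
    rw [show κ ^ 2 / 16 * S * Λ * N = (κ / 4) ^ 2 * (S * Λ * N) by ring,
      Real.sqrt_mul (by positivity), Real.sqrt_sq (by positivity)]
  have h2 : Real.sqrt (4 * (N / S)) = 2 * Real.sqrt (N / S) := by
    rw [show (4 : ℝ) * (N / S) = 2 ^ 2 * (N / S) by norm_num, Real.sqrt_mul (by norm_num),
      Real.sqrt_sq (by norm_num)]
  have h3 := sum_le_sqrt_mul_sum_sqrt s hm hU
  rw [h2] at h3
  have h4 : T = Real.sqrt Λ * Real.sqrt (S * N) := by
    rw [hT, ← Real.sqrt_mul hΛ.le]; congr 1; ring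
  have h5 : Real.sqrt (N / S) * Real.sqrt (S * N) = N := by
    rw [← Real.sqrt_mul (by positivity)]
    rw [show N / S * (S * N) = N ^ 2 by field_simp, Real.sqrt_sq hN.le]
  have h6 : Real.sqrt (S * N) ≤ 4 * ∑ i ∈ s, Real.sqrt (m i) := by
    have hp : 0 < Real.sqrt (N / S) := Real.sqrt_pos.2 (by positivity)
    refine le_of_mul_le_mul_left ?_ hp
    rw [h5]; linarith
  have h7 : κ * T ≤ ∑ i ∈ s, m i * β i := by
    refine le_trans ?_ (Finset.sum_le_sum hβ)
    rw [← Finset.mul_sum, h4]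
    have := mul_le_mul_of_nonneg_left h6 (by positivity : 0 ≤ κ * Real.sqrt Λ)
    have h8 : c * Real.sqrt v / 4 = 4 * κ := by rw [hκ]; ring
    rw [h8]; linarith
  rw [h1] at hW
  have h8 : κ * T ≤ 4 * ε * N := by linarith
  have h9 := pow_le_pow_left₀ (by positivity) h8 2
  rw [mul_pow, hTsq] at h9
  have h10 : κ ^ 2 * (S * Λ) ≤ 16 * ε ^ 2 * N := by
    refine le_of_mul_le_mul_right ?_ hN
    linarith
  rw [div_mul_eq_mul_div, div_le_iff₀ (by positivity)]
  linarith

/-! ### Exponential supermartingales -/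

theorem measureReal_exp_le_of_lintegral_le_one {Ω : Type*} [MeasurableSpace Ω] {P : Measure Ω}
    {Z : Ω → ENNReal} (hZ : Measurable Z) (h : ∫⁻ ω, Z ω ∂P ≤ 1) (u : ℝ) :
    P.real {ω | ENNReal.ofReal (Real.exp u) ≤ Z ω} ≤ Real.exp (-u) := by
  have h1 := (mul_meas_ge_le_lintegral (μ := P) hZ (ENNReal.ofReal (Real.exp u))).trans h
  refine ENNReal.toReal_le_of_le_ofReal (Real.exp_pos _).le ?_
  have hpos : ENNReal.ofReal (Real.exp u) ≠ 0 := by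
    simpa using Real.exp_pos u
  rw [Real.exp_neg, ENNReal.ofReal_inv_of_pos (Real.exp_pos u), ENNReal.le_inv_iff_mul_le,
    mul_comm]
  exact h1

namespace IsInteraction

open scoped ENNReal

variable {S A : Type} [Fintype S] {Ω : Type*} [mΩ : MeasurableSpace Ω]
  {M : MDP S A} {P : Measure Ω} {G : ℕ → ℕ → MeasurableSpace Ω} {τ : Interaction S A Ω}

theorem measurable_prod (hτ : IsInteraction M P G τ) {f : ℕ → Ω → ℝ≥0∞}
    (hf : ∀ k, Measurable[G (k + 1) 0] (f k)) (K : ℕ) :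
    Measurable[G K 0] fun ω => ∏ k ∈ Finset.range K, f k ω := by
  induction K with
  | zero => simp only [Finset.range_zero, Finset.prod_empty]; exact measurable_const
  | succ K ih =>
    simp_rw [Finset.prod_range_succ]
    exact (ih.mono ((hτ.G_zero_le K le_rfl).trans (hτ.G_episode K)) le_rfl).mul (hf K)

/-- The products form a supermartingale: the earlier factors are known when episode k reaches stage
h, so `hle` applies with their product as Z and removes the last factor. -/
theorem lintegral_prod_le_one [Finite A] [IsProbabilityMeasure P] (hτ : IsInteraction M P G τ)
    {h : ℕ} (hh : h ∈ Finset.Icc 1 M.H) {f : ℕ → Ω → ℝ≥0∞}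
    (hf : ∀ k, Measurable[G (k + 1) 0] (f k))
    (hle : ∀ k x a (Z : Ω → ℝ≥0∞), Measurable[G k h] Z →
      ∫⁻ ω in {ω | τ.state k h ω = x ∧ τ.action k h ω = a}, Z ω * f k ω ∂P
        ≤ ∫⁻ ω in {ω | τ.state k h ω = x ∧ τ.action k h ω = a}, Z ω ∂P) (K : ℕ) :
    ∫⁻ ω, ∏ k ∈ Finset.range K, f k ω ∂P ≤ 1 := by
  induction K with
  | zero => simp
  | succ K ih =>
    refine le_trans ?_ ih
    simp_rw [Finset.prod_range_succ]
    have hh' := Finset.mem_Icc.1 hh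
    exact hτ.lintegral_le_of_visit K hh fun x a => hle K x a _
      ((hτ.measurable_prod hf K).mono (hτ.G_zero_le K (by omega)) le_rfl)

/-! ### Measurability of the empirical means -/

theorem measurable_sum_visits (hτ : IsInteraction M P G τ) (k : ℕ) (x : S) (a : A)
    {f : ℕ × ℕ → Ω → ℝ} (hf : ∀ i, i.2 ∈ Finset.Icc 1 M.H → Measurable (f i)) :
    Measurable fun ω => ∑ i ∈ τ.visits M.H k x a ω, f i ω := by
  unfold Interaction.visits
  simp_rw [Finset.sum_filter]
  refine Finset.measurable_fun_sum _ fun i hi => ?_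
  have hi2 := (Finset.mem_product.1 hi).2
  exact Measurable.ite (hτ.G_le _ _ _ (hτ.measurableSet_visit i.1 hi2 x a)) (hf i hi2)
    measurable_const

theorem measurable_rhat (hτ : IsInteraction M P G τ) (k : ℕ) (x : S) (a : A) :
    Measurable (τ.rhat M.H k x a) := by
  unfold Interaction.rhat
  refine (hτ.measurable_sum_visits k x a fun i hi => hτ.measurable_reward i.1 hi).div ?_
  have : (fun ω => (τ.count M.H k x a ω : ℝ))
      = fun ω => ∑ i ∈ τ.visits M.H k x a ω, (fun (_ : ℕ × ℕ) (_ : Ω) => (1 : ℝ)) i ω := by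
    funext ω
    simp [Interaction.count]
  rw [this]
  exact hτ.measurable_sum_visits k x a fun _ _ => measurable_const

end IsInteraction

/-! ### The factors of the supermartingales in the hard instance -/

section Factors

open scoped ENNReal

variable {S : ℕ} {Ω : Type*} {τ : Interaction (HardState S) ℤˣ Ω}

open Classical in
/-- The factors of the supermartingale that controls the number of visits of `x`. -/
noncomputable def visitFactor (τ : Interaction (HardState S) ℤˣ Ω) (x : HardState S) (k : ℕ)
    (ω : Ω) : ℝ≥0∞ :=
  if τ.state k 1 ω = hardOrigin S ∧ τ.action k 1 ω = -1 then
    ENNReal.ofReal (Real.exp ((if τ.state k 2 ω = x then 1 else 0) - 2 / S)) else 1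

open Classical in
/-- The factors of the supermartingale that controls the noise. -/
noncomputable def noiseFactor (τ : Interaction (HardState S) ℤˣ Ω) (l : ℝ) (k : ℕ) (ω : Ω) :
    ℝ≥0∞ :=
  if (τ.state k 2 ω : ℤ) < 0 ∧ τ.action k 2 ω = 1 then
    ENNReal.ofReal (Real.exp (-l * (τ.reward k 2 ω - 1 / 2) - l ^ 2 / 32)) else 1

theorem IsHardPath.prod_visitFactor {ω : Ω} (hp : IsHardPath τ ω) {x : HardState S}
    (hx : (x : ℤ) < 0) (K : ℕ) :
    ∏ k ∈ Finset.range K, visitFactor τ x k ω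
      = ENNReal.ofReal (Real.exp (τ.endCount K x ω - 2 / S * τ.wrongCount K ω)) := by
  have hf : ∀ k, visitFactor τ x k ω = ENNReal.ofReal (Real.exp
      ((if τ.state k 2 ω = x then 1 else 0)
        - 2 / S * (if τ.action k 1 ω = -1 then 1 else 0))) := by
    intro k
    unfold visitFactor
    simp only [hp.init k, true_and]
    by_cases ha : τ.action k 1 ω = -1
    · simp [ha]
    · have hs : τ.state k 2 ω ≠ x := fun hs => ha ((hp.action_eq_iff k).2 (hs ▸ hx))
      simp [ha, hs]
  rw [Finset.prod_congr rfl fun k _ => hf k,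
    ← ENNReal.ofReal_prod_of_nonneg fun _ _ => (Real.exp_pos _).le, ← Real.exp_sum,
    Finset.sum_sub_distrib, ← Finset.mul_sum]
  simp [Interaction.endCount, Interaction.wrongCount]

theorem prod_noiseFactor (l : ℝ) (K : ℕ) (ω : Ω) :
    ∏ k ∈ Finset.range K, noiseFactor τ l k ω
      = ENNReal.ofReal (Real.exp (-l * τ.noiseSum K ω - l ^ 2 / 32 * τ.noiseCount K ω)) := by
  have hf : ∀ k, noiseFactor τ l k ω = ENNReal.ofReal (Real.exp
      (-l * (if (τ.state k 2 ω : ℤ) < 0 ∧ τ.action k 2 ω = 1 then τ.reward k 2 ω - 1 / 2 else 0)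
        - l ^ 2 / 32 * (if (τ.state k 2 ω : ℤ) < 0 ∧ τ.action k 2 ω = 1 then 1 else 0))) := by
    intro k
    unfold noiseFactor
    by_cases h : (τ.state k 2 ω : ℤ) < 0 ∧ τ.action k 2 ω = 1
    · simp only [if_pos h, mul_one]
    · simp only [if_neg h]; simp
  rw [Finset.prod_congr rfl fun k _ => hf k,
    ← ENNReal.ofReal_prod_of_nonneg fun _ _ => (Real.exp_pos _).le, ← Real.exp_sum,
    Finset.sum_sub_distrib, ← Finset.mul_sum, ← Finset.mul_sum]
  simp [Interaction.noiseSum, Interaction.noiseCount]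

end Factors

/-! ### Concentration in the hard instance -/

section HardConcentration

open scoped ENNReal

variable {S : ℕ} {hS : 1 ≤ S} {ε : ℝ} {h0 : 0 < ε} {h1 : ε < 1 / 8} {v : ℝ} {D : Measure ℝ}
  {hD : IsSymmetricNoise v D} {q : HardState S → HardState S → ℝ}
  {hq : ∀ x, q x ∈ stdSimplex ℝ (HardState S)}
  {Ω : Type*} [MeasurableSpace Ω] {P : Measure Ω}
  {G : ℕ → ℕ → MeasurableSpace Ω} {τ : Interaction (HardState S) ℤˣ Ω}

local notation "hM" => hardMDP S hS ε h0 h1 D hD q hq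

theorem hardMDP_p : (hM).p = hardTransition S q := rfl

theorem one_mem_stages : 1 ∈ Finset.Icc 1 (hM).H := Finset.mem_Icc.2 ⟨le_rfl, (hM).H_pos⟩

theorem two_mem_stages : 2 ∈ Finset.Icc 1 (hM).H := Finset.mem_Icc.2 ⟨by norm_num, le_rfl⟩

theorem measurable_visitFactor (hτ : IsInteraction (hM) P G τ) (x : HardState S) (k : ℕ) :
    Measurable[G (k + 1) 0] (visitFactor τ x k) := by
  have m1 : MeasurableSet[G (k + 1) 0]
      {ω | τ.state k 1 ω = hardOrigin S ∧ τ.action k 1 ω = -1} :=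
    hτ.G_le_next k (by change 1 ≤ 3; norm_num) _ (hτ.measurableSet_visit k
      one_mem_stages _ _)
  have m2 : MeasurableSet[G (k + 1) 0] {ω | τ.state k 2 ω = x} :=
    hτ.G_le_next k (by change 2 ≤ 3; norm_num) _ (hτ.state_meas k 2
      (Finset.mem_Icc.2 ⟨by norm_num, by change 2 ≤ 3; norm_num⟩) x)
  unfold visitFactor
  refine Measurable.ite m1 ?_ measurable_const
  exact (Real.measurable_exp.comp
    ((Measurable.ite m2 measurable_const measurable_const).sub measurable_const)).ennreal_ofReal

theorem measurable_noiseFactor (hτ : IsInteraction (hM) P G τ) (l : ℝ) (k : ℕ) :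
    Measurable[G (k + 1) 0] (noiseFactor τ l k) := by
  have m1 : MeasurableSet[G (k + 1) 0]
      {ω | (τ.state k 2 ω : ℤ) < 0 ∧ τ.action k 2 ω = 1} := by
    have : {ω | (τ.state k 2 ω : ℤ) < 0 ∧ τ.action k 2 ω = 1}
        = ⋃ x ∈ {x : HardState S | (x : ℤ) < 0},
          {ω | τ.state k 2 ω = x ∧ τ.action k 2 ω = 1} := by
      ext ω; simp
    rw [this]
    exact MeasurableSet.biUnion (Set.to_countable _) fun x _ =>
      hτ.G_le_next k (by change 2 ≤ 3; norm_num) _ (hτ.measurableSet_visit k two_mem_stages x 1)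
  have m2 : Measurable[G (k + 1) 0] (τ.reward k 2) :=
    (hτ.reward_meas k 2 two_mem_stages).mono (hτ.G_le_next k (h := 3) le_rfl) le_rfl
  unfold noiseFactor
  refine Measurable.ite m1 ?_ measurable_const
  exact (Real.measurable_exp.comp
    (((m2.sub measurable_const).const_mul _).sub measurable_const)).ennreal_ofReal

variable [IsProbabilityMeasure P]

theorem ae_isHardPath (hτ : IsInteraction (hM) P G τ) : ∀ᵐ ω ∂P, IsHardPath τ ω := by
  have e1 : ∀ᵐ ω ∂P, ∀ k, (hM).p0 (τ.state k 1 ω) ≠ 0 := ae_all_iff.2 hτ.ae_state_init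
  have e2 : ∀ᵐ ω ∂P, ∀ k, (hM).p (τ.state k 1 ω) (τ.action k 1 ω) (τ.state k 2 ω) ≠ 0 :=
    ae_all_iff.2 fun k => hτ.ae_state_next k one_mem_stages
  have e3 : ∀ᵐ ω ∂P, ∀ k x, τ.state k 2 ω = x → τ.action k 2 ω = -1 → τ.reward k 2 ω = 0 :=
    ae_all_iff.2 fun k => ae_all_iff.2 fun x =>
      hτ.ae_reward_eq_zero k two_mem_stages
        (by change hardReward S ε D x (-1) = _; simp [hardReward])
  filter_upwards [e1, e2, e3] with ω w1 w2 w3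
  have hi : ∀ k, τ.state k 1 ω = hardOrigin S := fun k => by
    by_contra hne
    refine w1 k ?_
    change (Pi.single (hardOrigin S) 1 : HardState S → ℝ) _ = 0
    rw [Pi.single_eq_of_ne hne]
  refine ⟨hi, fun k => ?_, fun k => w3 k _ rfl⟩
  by_contra hne
  refine w2 k ?_
  rw [hi k, hardMDP_p, hardTransition, if_pos (by rfl), if_neg hne]

theorem lintegral_prod_visitFactor_le (hτ : IsInteraction (hM) P G τ) {x : HardState S}
    (hx : (x : ℤ) < 0) (K : ℕ) :
    ∫⁻ ω, ∏ k ∈ Finset.range K, visitFactor τ x k ω ∂P ≤ 1 := by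
  refine hτ.lintegral_prod_le_one one_mem_stages (measurable_visitFactor hτ x) ?_ K
  intro k y a Z hZ
  have hAm := hτ.G_le k 1 _ (hτ.measurableSet_visit k one_mem_stages y a)
  have hTm := hτ.measurableSet_next k one_mem_stages x
  by_cases hya : y = hardOrigin S ∧ a = -1
  · obtain ⟨rfl, rfl⟩ := hya
    set c : ℝ := Real.exp (-(2 / S)) with hc
    have hc0 : 0 < c := Real.exp_pos _
    have he : (0 : ℝ) ≤ Real.exp 1 - 1 := by linarith [Real.add_one_le_exp (1 : ℝ)]
    -- The factor takes two values, c and c·e, so it is affine in the indicator of reaching x, whose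
    -- conditional probability is 1/S.
    have hcongr : ∫⁻ ω in {ω | τ.state k 1 ω = hardOrigin S ∧ τ.action k 1 ω = -1},
        Z ω * visitFactor τ x k ω ∂P
        = ∫⁻ ω in {ω | τ.state k 1 ω = hardOrigin S ∧ τ.action k 1 ω = -1},
          (ENNReal.ofReal c * Z ω + ENNReal.ofReal (c * (Real.exp 1 - 1))
            * {ω | τ.state k (1 + 1) ω = x}.indicator Z ω) ∂P := by
      refine setLIntegral_congr_fun hAm fun ω hω => ?_
      have hω' : τ.state k 1 ω = hardOrigin S ∧ τ.action k 1 ω = -1 := hω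
      simp only [visitFactor, if_pos hω']
      by_cases hs : τ.state k 2 ω = x
      · have hs' : ω ∈ {ω | τ.state k (1 + 1) ω = x} := hs
        rw [if_pos hs, Set.indicator_of_mem hs', ← add_mul,
          ← ENNReal.ofReal_add hc0.le (by positivity), mul_comm]
        congr 2
        rw [sub_eq_add_neg, Real.exp_add]; ring
      · have hs' : ω ∉ {ω | τ.state k (1 + 1) ω = x} := hs
        rw [if_neg hs, Set.indicator_of_notMem hs', mul_zero, add_zero, mul_comm, zero_sub]
    have hZ' : Measurable Z := hZ.mono (hτ.G_le k 1) le_rfl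
    rw [hcongr, lintegral_add_left (hZ'.const_mul _), lintegral_const_mul _ hZ',
      lintegral_const_mul _ (hZ'.indicator hTm), setLIntegral_indicator hTm, Set.inter_comm,
      hτ.setLIntegral_next k one_mem_stages _ _ hZ]
    have hp : (hM).p (hardOrigin S) (-1) x = 1 / S := by
      rw [hardMDP_p, hardTransition, if_pos (by rfl), if_pos (by simpa using hx)]
    rw [hp, ← mul_assoc, ← add_mul, ← ENNReal.ofReal_mul (by positivity),
      ← ENNReal.ofReal_add hc0.le (by positivity)]
    refine mul_le_of_le_one_left zero_le ?_
    rw [ENNReal.ofReal_le_one]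
    have hS' : (0 : ℝ) < S := by exact_mod_cast hS
    -- The conditional mean is c(1 + (e - 1)/S). As e - 1 < 2, the drift 2/S is large enough to
    -- bring it below 1.
    have h3 : c * (1 + 2 / S) ≤ 1 := by
      calc c * (1 + 2 / S) ≤ c * Real.exp (2 / S) := by
            refine mul_le_mul_of_nonneg_left ?_ hc0.le
            linarith [Real.add_one_le_exp (2 / (S : ℝ))]
        _ = 1 := by rw [hc, ← Real.exp_add]; simp
    have h4 : (Real.exp 1 - 1) * (1 / S) ≤ 2 / S := by
      rw [mul_one_div]
      gcongr
      linarith [Real.exp_one_lt_d9]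
    have h5 := mul_le_mul_of_nonneg_left h4 hc0.le
    linarith
  · refine (setLIntegral_congr_fun hAm fun ω hω => ?_).le
    have hω' : τ.state k 1 ω = y ∧ τ.action k 1 ω = a := hω
    simp only [visitFactor, hω'.1, hω'.2, if_neg hya, mul_one]

theorem lintegral_prod_noiseFactor_le (hτ : IsInteraction (hM) P G τ) (l : ℝ) (K : ℕ) :
    ∫⁻ ω, ∏ k ∈ Finset.range K, noiseFactor τ l k ω ∂P ≤ 1 := by
  refine hτ.lintegral_prod_le_one two_mem_stages (measurable_noiseFactor hτ l) ?_ K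
  intro k y a Z hZ
  have hAm := hτ.G_le k 2 _ (hτ.measurableSet_visit k two_mem_stages y a)
  by_cases hya : (y : ℤ) < 0 ∧ a = 1
  · have hcongr : ∫⁻ ω in {ω | τ.state k 2 ω = y ∧ τ.action k 2 ω = a},
        Z ω * noiseFactor τ l k ω ∂P
        = ∫⁻ ω in {ω | τ.state k 2 ω = y ∧ τ.action k 2 ω = a}, Z ω * (fun r =>
          ENNReal.ofReal (Real.exp (-l * (r - 1 / 2) - l ^ 2 / 32))) (τ.reward k 2 ω) ∂P := by
      refine setLIntegral_congr_fun hAm fun ω hω => ?_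
      have hω' : τ.state k 2 ω = y ∧ τ.action k 2 ω = a := hω
      simp only [noiseFactor, hω'.1, hω'.2, if_pos hya]
    rw [hcongr, hτ.setLIntegral_reward k two_mem_stages y a hZ
      (g := fun r => ENNReal.ofReal (Real.exp (-l * (r - 1 / 2) - l ^ 2 / 32))) (by fun_prop)]
    refine mul_le_of_le_one_left zero_le ?_
    rw [hya.2]
    exact lintegral_exp_hardReward_le hD hya.1 l
  · refine (setLIntegral_congr_fun hAm fun ω hω => ?_).le
    have hω' : τ.state k 2 ω = y ∧ τ.action k 2 ω = a := hω
    simp only [noiseFactor, hω'.1, hω'.2, if_neg hya, mul_one]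

/-- With high probability all negative states are visited at most about equally often. -/
theorem measureReal_visits_le (hτ : IsInteraction (hM) P G τ) (K : ℕ) {δ : ℝ} (hδ : 0 < δ) :
    P.real (⋃ x ∈ negStates S, {ω | ENNReal.ofReal (Real.exp (Real.log (S / δ)))
      ≤ ∏ k ∈ Finset.range K, visitFactor τ x k ω}) ≤ δ := by
  have hS' : (0 : ℝ) < S := by exact_mod_cast hS
  refine (measureReal_biUnion_finset_le _ _).trans ?_
  calc _ ≤ ∑ x ∈ negStates S, δ / S := by
        refine Finset.sum_le_sum fun x hx => ?_
        refine (measureReal_exp_le_of_lintegral_le_one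
          ((hτ.measurable_prod (measurable_visitFactor hτ x) K).mono (hτ.G_le K 0) le_rfl)
          (lintegral_prod_visitFactor_le hτ (mem_negStates.1 hx) K) _).trans_eq ?_
        rw [Real.exp_neg, Real.exp_log (by positivity), inv_div]
    _ = δ := by
        rw [Finset.sum_const, card_negStates, nsmul_eq_mul]; field_simp

/-- The noise is small simultaneously for all values up to `B` of the number of wrong plays. -/
theorem measureReal_noise_le (hτ : IsInteraction (hM) P G τ) (K : ℕ) {u B : ℝ} (hB : 0 ≤ B) :
    P.real (⋃ n ∈ Finset.Icc 1 ⌊B⌋₊, {ω | ENNReal.ofReal (Real.exp u)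
      ≤ ∏ k ∈ Finset.range K, noiseFactor τ (Real.sqrt (u / n)) k ω}) ≤ B * Real.exp (-u) := by
  refine (measureReal_biUnion_finset_le _ _).trans ?_
  calc _ ≤ ∑ n ∈ Finset.Icc 1 ⌊B⌋₊, Real.exp (-u) :=
        Finset.sum_le_sum fun n _ => measureReal_exp_le_of_lintegral_le_one
          ((hτ.measurable_prod (measurable_noiseFactor hτ _) K).mono (hτ.G_le K 0) le_rfl)
          (lintegral_prod_noiseFactor_le hτ _ K) _
    _ ≤ _ := by
        rw [Finset.sum_const, nsmul_eq_mul, Nat.card_Icc, Nat.add_sub_cancel]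
        exact mul_le_mul_of_nonneg_right (Nat.floor_le hB) (Real.exp_pos _).le

end HardConcentration

/-! ### The regret of optimistic algorithms on the hard instance -/

/-- On a good trajectory the wrong action has been played often by the time the optimistic value
is `ε`-accurate. -/
theorem wrongCount_lower_bound {S : ℕ} {Ω : Type*} {τ : Interaction (HardState S) ℤˣ Ω} {ω : Ω}
    {b : Bonuses (HardState S) ℤˣ Ω} {q : HardState S → HardState S → ℝ} {K : ℕ}
    {cbon cbar v δ ε : ℝ} (hS : 1 ≤ S) (hcbon : 0 < cbon) (hcbar : 0 < cbar) (hv : 0 < v)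
    (hδ : 0 < δ) (hδ8 : δ < 1 / 8) (hε : 0 < ε)
    (hεS : ε ≤ 1 / (⌈2 * (2 + 2 * (8 * cbar ^ 2 * (3 + 8 * cbar ^ 2) + 1)) / cbon * (S : ℝ)
      * Real.log ((S : ℝ) / δ)⌉₊ : ℝ))
    (hp : IsHardPath τ ω)
    (hinit : (fun x' => b.phatInit K (hardOrigin S) (-1) x' ω) ∈ stdSimplex ℝ (HardState S))
    (hinit0 : ∀ x', hardTransition S q (hardOrigin S) (-1) x' = 0 →
      b.phatInit K (hardOrigin S) (-1) x' ω = 0)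
    (hgreedy : ∀ k x a, b.optQ τ 2 k 2 x a ω ≤ b.optQ τ 2 k 2 x (τ.policy k ω 2 x) ω)
    (hstage : cbon / max 1 (τ.count 2 K (hardOrigin S) (-1) ω : ℝ)
      ≤ b.stage K 1 (hardOrigin S) (-1) ω)
    (hupper : ∀ k x a, b.rew k x a ω ≤ cbar * Real.sqrt
      (Real.log (((Fintype.card (HardState S) * Fintype.card ℤˣ * 2 : ℕ) : ℝ)
          * max 1 (τ.count 2 k x a ω : ℝ) / δ)
        / max 1 (τ.count 2 k x a ω : ℝ)))
    (hlower : ∀ x ∈ negStates S, cbon * Real.sqrt (v / 16 * Real.log (1 / δ)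
      / max 1 (τ.count 2 K x 1 ω : ℝ)) ≤ b.rew K x 1 ω)
    (horigin : 0 ≤ b.rew K (hardOrigin S) (-1) ω + τ.rhat 2 K (hardOrigin S) (-1) ω)
    (hcorrect : ∀ k (x : HardState S), (x : ℤ) ≠ 0 →
      1 / 2 ≤ b.rew k x 1 ω + τ.rhat 2 k x 1 ω)
    (hQ : b.optQ τ 2 K 1 (hardOrigin S) (-1) ω ≤ 1 / 2 + 2 * ε)
    (hvisits : ∀ x ∈ negStates S,
      (τ.endCount K x ω : ℝ) - 2 / S * τ.wrongCount K ω ≤ Real.log ((S : ℝ) / δ))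
    (hnoise : 1 ≤ τ.wrongCount K ω →
      (τ.wrongCount K ω : ℝ) ≤ (cbon * Real.sqrt v / 16) ^ 2 / 16 * S / ε ^ 2 * Real.log (1 / δ) →
      -(2 * Real.sqrt ((cbon * Real.sqrt v / 16) ^ 2 / 16 * S * Real.log (1 / δ)
        * τ.wrongCount K ω)) ≤ τ.noiseSum K ω) :
    (cbon * Real.sqrt v / 16) ^ 2 / 16 * S / ε ^ 2 * Real.log (1 / δ) ≤ τ.wrongCount K ω := by
  -- The noise is controlled only for counts up to the claimed bound, so the argument runs under the
  -- assumption that N is below it.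
  by_contra! hlt
  have hS' : (1 : ℝ) ≤ S := by exact_mod_cast hS
  have hlog8 : 1 ≤ Real.log 8 := by
    rw [Real.le_log_iff_exp_le (by norm_num)]
    linarith [Real.exp_one_lt_d9]
  have hSδ : 8 ≤ (S : ℝ) / δ := by rw [le_div_iff₀ hδ]; linarith
  have hℓ : 1 ≤ Real.log ((S : ℝ) / δ) := hlog8.trans (Real.log_le_log (by norm_num) hSδ)
  have hΛ : 0 < Real.log (1 / δ) := Real.log_pos (by rw [lt_div_iff₀ hδ]; linarith)
  set ℓ := Real.log ((S : ℝ) / δ) with hℓdef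
  set C := 8 * cbar ^ 2 * (3 + 8 * cbar ^ 2) + 1 with hC
  have hC1 : 0 ≤ C := by positivity
  have hSℓ : 1 ≤ (S : ℝ) * ℓ := one_le_mul_of_one_le_of_one_le hS' hℓ
  set X : ℝ := 2 * (2 + 2 * C) / cbon * (S : ℝ) * ℓ with hX
  have hX0 : 0 < X := by positivity
  have hεX : ε * X ≤ 1 := by
    have h1 : ε ≤ 1 / X :=
      hεS.trans (one_div_le_one_div_of_le hX0 (Nat.le_ceil X))
    rwa [le_div_iff₀ hX0] at h1
  set N : ℝ := (τ.wrongCount K ω : ℝ) with hN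
  -- A first, weaker bound from the transition bonus: `cbon / max 1 N` is at most 2ε, and ε ≤ 1/X.
  -- Its right side is at least 2, so the maximum is N itself.
  have hmax : (2 + 2 * C) * (S * ℓ) ≤ max 1 N := by
    have hpos : 0 < max 1 N := lt_of_lt_of_le one_pos (le_max_left _ _)
    have h1 := (optQ_one_neg_one_ge hp hinit hinit0 hstage horigin (hcorrect K)).trans hQ
    have h2 : cbon ≤ 2 * ε * max 1 N := by
      rw [← div_le_iff₀ hpos]; linarith
    have h3 : cbon * X = 2 * ((2 + 2 * C) * (S * ℓ)) := by rw [hX]; field_simp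
    have h4 : cbon * X ≤ 2 * max 1 N := by
      calc cbon * X ≤ 2 * ε * max 1 N * X := mul_le_mul_of_nonneg_right h2 hX0.le
        _ = 2 * max 1 N * (ε * X) := by ring
        _ ≤ 2 * max 1 N := mul_le_of_le_one_right (by positivity) hεX
    linarith
  have hCS : 0 ≤ C * (S * ℓ) := by positivity
  have hmaxN : max 1 N = N := by
    rcases max_choice 1 N with h | h
    · rw [h] at hmax; linarith
    · exact h
  rw [hmaxN] at hmax
  have hN0 : 0 < N := by linarith
  have hN1 : 1 ≤ τ.wrongCount K ω := by
    rw [Nat.one_le_iff_ne_zero]; rintro h; rw [hN, h] at hN0; simp at hN0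
  have hne : ∀ x ∈ negStates S, (x : ℤ) ≠ 0 := fun x hx => (mem_negStates.1 hx).ne
  have hU : ∀ x ∈ negStates S, (τ.count 2 K x 1 ω : ℝ) ≤ 4 * (N / S) := by
    intro x hx
    have h1 : (τ.count 2 K x 1 ω : ℝ) + τ.count 2 K x (-1) ω = τ.endCount K x ω := by
      exact_mod_cast hp.count_add_count K (hne x hx)
    have h2 := hvisits x hx
    have h3 : 2 / (S : ℝ) * N = 2 * (N / S) := by ring
    -- The additive error ℓ in the visit bound is thereby absorbed into the multiplicative one. The
    -- part 2C of the constant serves the next step, where the wasted visits CSℓ must not exceed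
    -- N/2.
    have h4 : 2 * ℓ ≤ N / S := by
      rw [le_div_iff₀ (by linarith)]; linarith
    have h5 : (0 : ℝ) ≤ τ.count 2 K x (-1) ω := Nat.cast_nonneg _
    rw [h3] at h2
    linarith
  have hsum : N / 2 ≤ ∑ x ∈ negStates S, (τ.count 2 K x 1 ω : ℝ) := by
    have h1 : ∑ x ∈ negStates S, ((τ.endCount K x ω : ℝ) - C * ℓ)
        ≤ ∑ x ∈ negStates S, (τ.count 2 K x 1 ω : ℝ) := by
      refine Finset.sum_le_sum fun x hx => ?_
      have h1 : (τ.count 2 K x 1 ω : ℝ) + τ.count 2 K x (-1) ω = τ.endCount K x ω := by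
        exact_mod_cast hp.count_add_count K (hne x hx)
      have h2 := count_neg_one_le hcbar hS hδ hδ8 hp hgreedy hupper (hne x hx)
        (fun k => hcorrect k x (hne x hx)) K
      linarith
    rw [Finset.sum_sub_distrib, Finset.sum_const, card_negStates, nsmul_eq_mul,
      ← Nat.cast_sum, hp.sum_endCount K] at h1
    linarith
  have hβ : ∀ x ∈ negStates S, cbon * Real.sqrt v / 4 * Real.sqrt (Real.log (1 / δ))
      * Real.sqrt (τ.count 2 K x 1 ω) ≤ (τ.count 2 K x 1 ω : ℝ) * b.rew K x 1 ω := by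
    intro x hx
    have h1 := hlower x hx
    -- An unvisited state has weight 0. Otherwise m·√(vΛ/(16m)) = (√v/4)·√Λ·√m.
    rcases Nat.eq_zero_or_pos (τ.count 2 K x 1 ω) with h | h
    · rw [h]; simp
    · have hm : (1 : ℝ) ≤ τ.count 2 K x 1 ω := by exact_mod_cast h
      set m : ℝ := (τ.count 2 K x 1 ω : ℝ) with hmdef
      rw [max_eq_right hm] at h1
      refine le_trans (le_of_eq ?_) (mul_le_mul_of_nonneg_left h1 (by linarith))
      rw [Real.sqrt_div (by positivity), Real.sqrt_mul (by positivity),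
        show v / 16 = v / 4 ^ 2 by norm_num, Real.sqrt_div hv.le, Real.sqrt_sq (by norm_num)]
      have hsm : 0 < Real.sqrt m := Real.sqrt_pos.2 (by linarith)
      have hmm : m = Real.sqrt m * Real.sqrt m := (Real.mul_self_sqrt (by linarith)).symm
      field_simp
      rw [Real.sq_sqrt (by linarith)]
  have hbonus := noiseSum_add_bonus_le hp (by omega) (le_trans (by positivity) hstage)
    horigin (hcorrect K)
  have hfin := count_lower_bound (negStates S) hcbon hv hΛ (by linarith) hN0 hε
    (fun x _ => Nat.cast_nonneg (τ.count 2 K x 1 ω)) hU hsum hβ (hnoise hN1 hlt.le)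
    (hbonus.trans (mul_le_mul_of_nonneg_right (by linarith) hN0.le))
  exact absurd hfin (not_le.2 hlt)

/-- With l = √(u/N) the compensator is at most u/32, so -l times the noise sum is below 2u, and u/l
= √(uN). This l depends on the random N, whereas the supermartingale needs a fixed one; hence the
union over all values of N in `measureReal_noise_le`. -/
theorem noiseSum_ge_of_lt {S : ℕ} {Ω : Type*} {τ : Interaction (HardState S) ℤˣ Ω} {ω : Ω}
    (hp : IsHardPath τ ω) {K : ℕ} {u : ℝ} (hu : 0 < u) (hN : 1 ≤ τ.wrongCount K ω)
    (h : ∏ k ∈ Finset.range K, noiseFactor τ (Real.sqrt (u / τ.wrongCount K ω)) k ω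
      < ENNReal.ofReal (Real.exp u)) :
    -(2 * Real.sqrt (u * τ.wrongCount K ω)) ≤ τ.noiseSum K ω := by
  have hN0 : (0 : ℝ) < τ.wrongCount K ω := by exact_mod_cast hN
  have hm : (τ.noiseCount K ω : ℝ) ≤ τ.wrongCount K ω := by exact_mod_cast hp.noiseCount_le K
  set N : ℝ := (τ.wrongCount K ω : ℝ) with hNdef
  rw [prod_noiseFactor, ENNReal.ofReal_lt_ofReal_iff (Real.exp_pos _), Real.exp_lt_exp,
    Real.sq_sqrt (by positivity)] at h
  have hl : 0 < Real.sqrt (u / N) := Real.sqrt_pos.2 (by positivity)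
  have h1 : u / N / 32 * τ.noiseCount K ω ≤ u := by
    calc u / N / 32 * τ.noiseCount K ω ≤ u / N / 32 * N :=
          mul_le_mul_of_nonneg_left hm (by positivity)
      _ = u / 32 := by field_simp
      _ ≤ u := by linarith
  have h2 : Real.sqrt (u / N) * Real.sqrt (u * N) = u := by
    rw [← Real.sqrt_mul (by positivity), show u / N * (u * N) = u ^ 2 by field_simp,
      Real.sqrt_sq hu.le]
  refine le_of_mul_le_mul_left ?_ hl
  linarith

section Regret

variable {S : ℕ} {hS : 1 ≤ S} {ε : ℝ} {h0 : 0 < ε} {h1 : ε < 1 / 8} {v : ℝ} {D : Measure ℝ}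
  {hD : IsSymmetricNoise v D} {q : HardState S → HardState S → ℝ}
  {hq : ∀ x, q x ∈ stdSimplex ℝ (HardState S)}

local notation "hM" => hardMDP S hS ε h0 h1 D hD q hq

theorem wrongCount_mul_le_regret {Ω : Type*} {τ : Interaction (HardState S) ℤˣ Ω} {ω : Ω}
    (hp : IsHardPath τ ω) (K : ℕ) : τ.wrongCount K ω * ε ≤ τ.regret (hM) K ω := by
  unfold Interaction.regret Interaction.wrongCount
  rw [← nsmul_eq_mul, ← Finset.sum_const, Finset.sum_filter]
  refine Finset.sum_le_sum fun k _ => ?_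
  have h := hardMDP_value0_le (hS := hS) (h0 := h0) (h1 := h1) (hD := hD) (hq := hq)
    (τ.policy k ω)
  rw [hardMDP_optValue0, Interaction.action, hp.init k]
  linarith

theorem hardMDP_optV0 {Ω : Type*} (τ : Interaction (HardState S) ℤˣ Ω)
    (b : Bonuses (HardState S) ℤˣ Ω) (k : ℕ) (ω : Ω) :
    b.optV0 τ (hM) k ω = ⨆ a, b.optQ τ 2 k 1 (hardOrigin S) a ω := by
  change ∑ x, (Pi.single (hardOrigin S) 1 : HardState S → ℝ) x * b.optV τ 2 k 1 x ω = _
  simp [Pi.single_apply, Bonuses.optV]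

theorem hardMDP_regret_lower_bound {cbon cbar δ : ℝ} (hcbon : 0 < cbon) (hcbar : 0 < cbar)
    (hv : 0 < v) (hδ : 0 < δ) (hδ8 : δ < 1 / 8)
    (hεS : ε ≤ 1 / (⌈2 * (2 + 2 * (8 * cbar ^ 2 * (3 + 8 * cbar ^ 2) + 1)) / cbon * (S : ℝ)
      * Real.log ((S : ℝ) / δ)⌉₊ : ℝ))
    {c : ℝ} (hc : c = (cbon * Real.sqrt v / 16) ^ 2 / 16)
    {Ω : Type*} [MeasurableSpace Ω] {P : Measure Ω} [IsProbabilityMeasure P]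
    {G : ℕ → ℕ → MeasurableSpace Ω} {τ : Interaction (HardState S) ℤˣ Ω}
    {b : Bonuses (HardState S) ℤˣ Ω} (hrun : IsOptimisticRun (hM) P G τ b cbon cbar δ) :
    ∃ K₀ : ℕ, ∀ K : ℕ, K₀ ≤ K →
      1 - c * (S : ℝ) * (1 / ε ^ 2) * Real.log (1 / δ) * Real.exp (-c * (S : ℝ)) - 3 * δ
        ≤ P.real {ω | c * (S : ℝ) / ε * Real.log (1 / δ) ≤ τ.regret (hM) K ω} := by
  obtain ⟨K₀, hK₀⟩ := hrun.consistent ε h0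
  refine ⟨K₀, fun K hK => ?_⟩
  have hτ := hrun.interaction
  have hS' : (1 : ℝ) ≤ S := by exact_mod_cast hS
  have hc0 : 0 < c := by rw [hc]; positivity
  have hΛ1 : 1 ≤ Real.log (1 / δ) := by
    rw [Real.le_log_iff_exp_le (by positivity), le_div_iff₀ hδ]
    have := Real.exp_one_lt_d9
    nlinarith
  set Λ := Real.log (1 / δ) with hΛ
  set u := c * S * Λ with hu
  have hu0 : 0 < u := by positivity
  set B := c * S / ε ^ 2 * Λ with hB
  have hB0 : 0 ≤ B := by positivity
  set E₁ := {ω | ∀ k, K₀ ≤ k → b.optV0 τ (hM) k ω - (hM).optValue0 ≤ ε} with hE₁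
  set E₂ := {ω | ∀ k x a, (hM).r x a ≤ b.rew k x a ω + τ.rhat (hM).H k x a ω} with hE₂
  set F₁ := ⋃ x ∈ negStates S, {ω | ENNReal.ofReal (Real.exp (Real.log (S / δ)))
      ≤ ∏ k ∈ Finset.range K, visitFactor τ x k ω} with hF₁
  set F₂ := ⋃ n ∈ Finset.Icc 1 ⌊B⌋₊, {ω | ENNReal.ofReal (Real.exp u)
      ≤ ∏ k ∈ Finset.range K, noiseFactor τ (Real.sqrt (u / n)) k ω} with hF₂
  -- Needed to pass to the complement. The consistency event enters only through monotonicity of the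
  -- measure, so its measurability is not needed.
  have hE₂m : MeasurableSet E₂ := by
    have : E₂ = ⋂ k, ⋂ x, ⋂ a,
        {ω | (hM).r x a ≤ b.rew k x a ω + τ.rhat (hM).H k x a ω} := by
      ext ω; simp [hE₂]
    rw [this]
    exact MeasurableSet.iInter fun k => MeasurableSet.iInter fun x => MeasurableSet.iInter fun a =>
      measurableSet_le measurable_const
        (((hrun.rew_meas k x a).mono (hτ.G_le k 0) le_rfl).add (hτ.measurable_rhat k x a))
  have hP₂ : P.real E₂ᶜ ≤ δ := by
    rw [probReal_compl_eq_one_sub hE₂m]; linarith [hrun.correct]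
  have hP₁ : P.real F₁ ≤ δ := measureReal_visits_le hτ K hδ
  have hP₃ : P.real F₂ ≤ B * Real.exp (-u) := measureReal_noise_le hτ K hB0
  set T := {ω | c * (S : ℝ) / ε * Λ ≤ τ.regret (hM) K ω} with hT
  have hincl : ∀ᵐ ω ∂P, ω ∈ E₁ → ω ∈ T ∪ (E₂ᶜ ∪ (F₁ ∪ F₂)) := by
    filter_upwards [ae_isHardPath hτ, hrun.phatInit_prob, hrun.greedy, hrun.stage_lower,
      hrun.rew_lower, hrun.rew_upper] with ω hp hinit hgreedy hstage hlower hupper hω₁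
    by_contra hbad
    simp only [Set.mem_union, not_or, Set.mem_compl_iff, not_not] at hbad
    obtain ⟨hωT, hω₂, hωF₁, hωF₂⟩ := hbad
    have hcor : ∀ k x a, (hM).r x a ≤ b.rew k x a ω + τ.rhat 2 k x a ω := hω₂
    refine hωT ?_
    have hlow := wrongCount_lower_bound (K := K) hS hcbon hcbar hv hδ hδ8 h0 hεS hp
      (hinit K (hardOrigin S) (-1)).1 (q := q) (hinit K (hardOrigin S) (-1)).2
      (fun k x a => hgreedy k 2 two_mem_stages x a)
      (hstage K (hardOrigin S) (-1) 1 (Finset.mem_Ico.2 ⟨le_rfl, by change 1 < 2; norm_num⟩))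
      hupper ?_ ?_ ?_ ?_ ?_ ?_
    · rw [← hc] at hlow
      refine le_trans ?_ (wrongCount_mul_le_regret hp K)
      refine le_trans (le_of_eq ?_) (mul_le_mul_of_nonneg_right hlow h0.le)
      rw [← hΛ]
      field_simp
    · intro x hx
      refine le_trans ?_ (hlower K x 1)
      have hvar := hardMDP_rewardVar_negative (hS := hS) (h0 := h0) (h1 := h1) (hD := hD)
        (hq := hq) (mem_negStates.1 hx)
      change _ ≤ cbon * Real.sqrt (_ / max 1 (τ.count 2 K x 1 ω : ℝ))
      gcongr
    · have := hcor K (hardOrigin S) (-1)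
      rwa [hardMDP_r_origin] at this
    · intro k x hx
      exact (hardMDP_half_le_r hx).trans (hcor k x 1)
    -- Consistency with tolerance ε gives 1/2 + ε + ε for the maximum, hence for the wrong action.
    · have h2 : b.optV0 τ (hM) K ω - (hM).optValue0 ≤ ε := hω₁ K hK
      rw [hardMDP_optV0, hardMDP_optValue0] at h2
      have h3 := le_ciSup (f := fun a => b.optQ τ 2 K 1 (hardOrigin S) a ω)
        (Set.finite_range _).bddAbove (-1)
      linarith
    · intro x hx
      by_contra! hgt
      refine hωF₁ (Set.mem_biUnion hx ?_)
      rw [Set.mem_ofPred_eq, hp.prod_visitFactor (mem_negStates.1 hx)]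
      exact ENNReal.ofReal_le_ofReal (Real.exp_le_exp.2 hgt.le)
    · intro hN1 hNB
      rw [← hc] at hNB ⊢
      refine noiseSum_ge_of_lt hp hu0 hN1 ?_
      by_contra! hge
      exact hωF₂ (Set.mem_biUnion
        (Finset.mem_coe.2 (Finset.mem_Icc.2 ⟨hN1, Nat.le_floor hNB⟩)) hge)
  have hmono : P.real E₁ ≤ P.real (T ∪ (E₂ᶜ ∪ (F₁ ∪ F₂))) :=
    ENNReal.toReal_mono (measure_ne_top _ _) (measure_mono_ae hincl)
  have hunion : P.real (T ∪ (E₂ᶜ ∪ (F₁ ∪ F₂)))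
      ≤ P.real T + (P.real E₂ᶜ + (P.real F₁ + P.real F₂)) :=
    (measureReal_union_le _ _).trans (add_le_add_right
      ((measureReal_union_le _ _).trans (add_le_add_right (measureReal_union_le _ _) _)) _)
  have hexp : B * Real.exp (-u)
      ≤ c * (S : ℝ) * (1 / ε ^ 2) * Λ * Real.exp (-c * (S : ℝ)) := by
    have h2 : B = c * (S : ℝ) * (1 / ε ^ 2) * Λ := by rw [hB]; ring
    rw [← h2]
    refine mul_le_mul_of_nonneg_left (Real.exp_le_exp.2 ?_) hB0
    -- As δ < 1/8 < 1/e, Λ is at least 1 and may be dropped from the exponent.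
    have h3 : c * S * 1 ≤ c * S * Λ := mul_le_mul_of_nonneg_left hΛ1 (by positivity)
    linarith
  linarith

end Regret

theorem mainTheorem4 :
    ∃ C₀ : ℝ, 0 < C₀ ∧
    ∀ cbon cbar v : ℝ, 0 < cbon → 0 < cbar → 0 < v →
    ∃ c₁ c₂ c₃ C₁ : ℝ, 0 < c₁ ∧ 0 < c₂ ∧ 0 < c₃ ∧ 0 < C₁ ∧
    ∀ (δ : ℝ), 0 < δ → δ < 1 / 8 →
    ∀ (S : ℕ) (hS : 1 ≤ S) (ε : ℝ) (h0 : 0 < ε) (h1 : ε < 1 / 8),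
    ε ≤ 1 / (⌈c₁ * (S : ℝ) * Real.log ((S : ℝ) / δ)⌉₊ : ℝ) →
    ∀ (D : MeasureTheory.Measure ℝ) (hD : IsSymmetricNoise v D)
      (q : HardState S → HardState S → ℝ) (hq : ∀ x, q x ∈ stdSimplex ℝ (HardState S))
      (M : MDP (HardState S) ℤˣ), M = hardMDP S hS ε h0 h1 D hD q hq →
    -- size of the instance and its gaps
    (Fintype.card (HardState S) = 2 * S + 1 ∧ Fintype.card ℤˣ = 2 ∧ M.H = 2) ∧
    (M.gap 1 (hardOrigin S) (-1) = ε ∧ IsLeast M.positiveGaps ε ∧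
      (∀ h ∈ Finset.Icc 1 M.H, ∀ x, M.gap h x 1 = 0) ∧
      (∀ h ∈ Finset.Icc 1 M.H, ∀ x, x ≠ hardOrigin S → 1 / 2 ≤ M.gap h x (-1)) ∧
      (∀ h ∈ Finset.Icc 1 M.H, ∀ x a, (h, x, a) ≠ (1, hardOrigin S, -1) →
        0 < M.gap h x a → 1 / 2 ≤ M.gap h x a)) ∧
    M.sumInvGaps ≤ C₀ * ((S : ℝ) + 1 / ε) ∧
    M.sumInvGaps + (S : ℝ) / ε ≤ C₁ * (c₂ * (S : ℝ) / ε * Real.log (1 / δ)) ∧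
    -- regret of every algorithm of the class
    ∀ (Ω : Type*) [MeasurableSpace Ω] (P : MeasureTheory.Measure Ω)
      [MeasureTheory.IsProbabilityMeasure P] (G : ℕ → ℕ → MeasurableSpace Ω)
      (τ : Interaction (HardState S) ℤˣ Ω) (b : Bonuses (HardState S) ℤˣ Ω),
      IsOptimisticRun M P G τ b cbon cbar δ →
      ∃ K₀ : ℕ, ∀ K : ℕ, K₀ ≤ K →
        1 - c₂ * (S : ℝ) * (1 / ε ^ 2) * Real.log (1 / δ) * Real.exp (-c₃ * (S : ℝ)) - 3 * δ
          ≤ P.real {ω | c₂ * (S : ℝ) / ε * Real.log (1 / δ) ≤ τ.regret M K ω} := by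

  refine ⟨16, by norm_num, fun cbon cbar v hcbon hcbar hv => ?_⟩
  set c := (cbon * Real.sqrt v / 16) ^ 2 / 16 with hc
  have hc0 : 0 < c := by positivity
  -- The first witness is the constant of X in `wrongCount_lower_bound`. In 33/c, 32 bounds 16(S +
  -- 1/ε) by multiples of S/ε, and 1 accounts for the extra S/ε.
  refine ⟨2 * (2 + 2 * (8 * cbar ^ 2 * (3 + 8 * cbar ^ 2) + 1)) / cbon, c, c, 33 / c,
    by positivity, hc0, hc0, by positivity, ?_⟩
  rintro δ hδ hδ8 S hS ε h0 h1 hεS D hD q hq M rfl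
  have hS' : (1 : ℝ) ≤ S := by exact_mod_cast hS
  refine ⟨⟨card_hardState, Fintype.card_units_int, rfl⟩,
    ⟨hardMDP_gap_one_origin_neg_one, hardMDP_isLeast_positiveGaps,
      fun h hh x => hardMDP_gap_eq_zero hh x,
      fun h hh x hx => hardMDP_half_le_gap hh fun h2 => hx (hardState_eq_origin.2 h2),
      fun h hh x a hne hpos => hardMDP_half_le_gap_of_pos hh hne hpos⟩,
    hardMDP_sumInvGaps_le, ?_, ?_⟩
  · have hΛ1 : 1 ≤ Real.log (1 / δ) := by
      rw [Real.le_log_iff_exp_le (by positivity), le_div_iff₀ hδ]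
      have := Real.exp_one_lt_d9
      nlinarith
    have h2 : (S : ℝ) ≤ S / ε := by
      rw [le_div_iff₀ h0]; exact mul_le_of_le_one_right (by linarith) (by linarith)
    have h3 : 1 / ε ≤ S / ε := by gcongr
    have h4 := hardMDP_sumInvGaps_le (hS := hS) (h0 := h0) (h1 := h1) (hD := hD) (hq := hq)
    have h5 : 33 / c * (c * (S : ℝ) / ε * Real.log (1 / δ))
        = 33 * (S / ε * Real.log (1 / δ)) := by field_simp
    have h6 : (S : ℝ) / ε ≤ S / ε * Real.log (1 / δ) :=
      le_mul_of_one_le_right (by positivity) hΛ1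
    rw [h5]
    linarith
  · intro Ω _ P _ G τ b hrun
    exact hardMDP_regret_lower_bound hcbon hcbar hv hδ hδ8 hεS hc hrun
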